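/- Theorem. The vector connectivity problem VecCon can be solved in polynomial time if all requirements are at most $2$. Here, for a finite simple undirected graph $G=(V,E)$, a set $S\subseteq V$ and a vertex $v\in V\setminus S$, a $v$--$S$ fan of order $k$ is a collection of $k$ paths $P_1,\dots,P_k$ in $G$, each connecting $v$ to a vertex of $S$, such that $V(P_i)\cap V(P_j)=\{v\}$ for all $i\ne j$. For a requirement function $r:V\to\{0,1,2,\dots\}$, a vector connectivity set for $(G,r)$ is a set $S\subseteq V$ such that every $v\in V\setminus S$ has a $v$--$S$ fan of order $r(v)$. VecCon asks, given $(G,r)$, for a vector connectivity set of minimum cardinality. The theorem says: there are a deterministic algorithm (a random access machine program with unit-cost addition and subtraction) and a polynomial $p$ such that for every finite simple graph $G$ (given by the number of its vertices and its adjacency matrix) and every $r:V\to\{0,1,2\}$, the algorithm halts on input $(G,r)$ after at most $p(N)$ steps, where $N$ is the total binary length of the input, and outputs a minimum-cardinality vector connectivity set for $(G,r)$. -/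

import Mathlib

/-! ### Vector connectivity -/

namespace VecCon

/-- `IsLinked G k v S`: there is a `v`--`S` fan of order `k` in `G`, that is, a family of `k` paths,
each connecting `v` to a vertex of `S`, any two of which have exactly the vertex `v` in common. -/
def IsLinked {V : Type*} (G : SimpleGraph V) (k : ℕ) (v : V) (S : Set V) : Prop :=
  ∃ (w : Fin k → V) (p : ∀ i, G.Path v (w i)),
    (∀ i, w i ∈ S) ∧
    ∀ i j, i ≠ j →
      {x | x ∈ (p i : G.Walk v (w i)).support} ∩ {x | x ∈ (p j : G.Walk v (w j)).support} = {v}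

/-- `S` is a vector connectivity set for `(G, r)`: every vertex `v` outside `S` has a `v`--`S` fan
of order `r v`. -/
def IsVectorConnectivitySet {V : Type*} (G : SimpleGraph V) (r : V → ℕ) (S : Set V) : Prop :=
  ∀ v, v ∉ S → IsLinked G (r v) v S

/-- `S` is a vector connectivity set for `(G, r)` of minimum cardinality. -/
def IsMinVectorConnectivitySet {V : Type*} (G : SimpleGraph V) (r : V → ℕ) (S : Finset V) :
    Prop :=
  IsVectorConnectivitySet G r (S : Set V) ∧
    ∀ S' : Finset V, IsVectorConnectivitySet G r (S' : Set V) → S.card ≤ S'.card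

/-- An instance of the problem: a finite simple graph on the vertices `0, …, n - 1` and a
requirement for every vertex (not assumed to be at most the degree). -/
structure Input where
  n : ℕ
  graph : SimpleGraph (Fin n)
  req : Fin n → ℕ

open Classical in
/-- The input string: the number of vertices, then the adjacency matrix row by row (entries `0`
and `1`), then the requirements. -/
noncomputable def Input.encode (I : Input) : List ℕ :=
  I.n ::
    ((List.ofFn fun u : Fin I.n => List.ofFn fun v : Fin I.n =>
        if I.graph.Adj u v then 1 else 0).flatten ++
      List.ofFn I.req)

/-- The output string for a vertex set: its characteristic vector. -/
def encodeSet {n : ℕ} (S : Finset (Fin n)) : List ℕ :=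
  List.ofFn fun v : Fin n => if v ∈ S then 1 else 0

end VecCon

/-! ### Random access machines

Deterministic random access machines with unit cost, whose only arithmetic operations are addition
and (truncated) subtraction.  Without multiplication, a number computed in `t` steps has only `t`
bits more than the largest number in the input or the program, so that polynomial time on these
machines is polynomial time on Turing machines. -/

namespace RAM

/-- A configuration: registers, which a program names directly, and a memory addressed through
registers.  All cells hold natural numbers. -/
structure State where
  reg : ℕ → ℕ
  mem : ℕ → ℕ

/-- The configuration with register `d` set to `x`. -/
def State.setReg (s : State) (d x : ℕ) : State :=
  { s with reg := Function.update s.reg d x }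

/-- The configuration with memory cell `a` set to `x`. -/
def State.setMem (s : State) (a x : ℕ) : State :=
  { s with mem := Function.update s.mem a x }

/-- Programs; all arguments of type `ℕ` are names of registers, except the constant `c`. -/
inductive Program
  | skip
  | const (d c : ℕ)
  | copy (d a : ℕ)
  | add (d a b : ℕ)
  | sub (d a b : ℕ)
  | load (d a : ℕ)
  | store (a b : ℕ)
  | seq (P Q : Program)
  | ifNonzero (a : ℕ) (P Q : Program)
  | whileNonzero (a : ℕ) (P : Program)

/-- `Exec P s t s'`: started in configuration `s`, the program `P` halts after exactly `t` steps in
configuration `s'`.  Every elementary instruction and every test of a register costs one step. -/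
inductive Exec : Program → State → ℕ → State → Prop
  | skip (s : State) : Exec .skip s 1 s
  | const (d c : ℕ) (s : State) : Exec (.const d c) s 1 (s.setReg d c)
  | copy (d a : ℕ) (s : State) : Exec (.copy d a) s 1 (s.setReg d (s.reg a))
  | add (d a b : ℕ) (s : State) : Exec (.add d a b) s 1 (s.setReg d (s.reg a + s.reg b))
  | sub (d a b : ℕ) (s : State) : Exec (.sub d a b) s 1 (s.setReg d (s.reg a - s.reg b))
  | load (d a : ℕ) (s : State) : Exec (.load d a) s 1 (s.setReg d (s.mem (s.reg a)))
  | store (a b : ℕ) (s : State) : Exec (.store a b) s 1 (s.setMem (s.reg a) (s.reg b))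
  | seq {P Q : Program} {s₁ s₂ s₃ : State} {t u : ℕ}
      (h₁ : Exec P s₁ t s₂) (h₂ : Exec Q s₂ u s₃) : Exec (.seq P Q) s₁ (t + u) s₃
  | if_true {a : ℕ} {P Q : Program} {s s' : State} {t : ℕ}
      (h : s.reg a ≠ 0) (h₁ : Exec P s t s') : Exec (.ifNonzero a P Q) s (t + 1) s'
  | if_false {a : ℕ} {P Q : Program} {s s' : State} {t : ℕ}
      (h : s.reg a = 0) (h₁ : Exec Q s t s') : Exec (.ifNonzero a P Q) s (t + 1) s'
  | while_false {a : ℕ} {P : Program} {s : State}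
      (h : s.reg a = 0) : Exec (.whileNonzero a P) s 1 s
  | while_true {a : ℕ} {P : Program} {s₁ s₂ s₃ : State} {t u : ℕ}
      (h : s₁.reg a ≠ 0) (h₁ : Exec P s₁ t s₂) (h₂ : Exec (.whileNonzero a P) s₂ u s₃) :
      Exec (.whileNonzero a P) s₁ (t + u + 1) s₃

/-- The initial configuration: the input stands at the beginning of the memory, register `0` holds
its length, and everything else is `0`. -/
def State.init (x : List ℕ) : State where
  reg i := if i = 0 then x.length else 0
  mem i := x.getD i 0

/-- A configuration shows the output `y` when `y` stands at the beginning of the memory and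
register `0` holds the length of `y`. -/
def State.Shows (s : State) (y : List ℕ) : Prop :=
  s.reg 0 = y.length ∧ ∀ (i : ℕ) (h : i < y.length), s.mem i = y[i]

/-- On input `x`, the program `P` halts with output `y` after at most `T` steps. -/
def OutputsInTime (P : Program) (x y : List ℕ) (T : ℕ) : Prop :=
  ∃ t s, Exec P (State.init x) t s ∧ t ≤ T ∧ s.Shows y

/-- The size of an input: the total number of binary digits, with one separator per number. -/
def inputSize (x : List ℕ) : ℕ :=
  (x.map fun a => a.size + 1).sum

/-- A search problem is given by encodings of its instances and of its candidate solutions and by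
the relation `Sol a b` (`b` is a solution of `a`).  It is solvable in polynomial time if a single
program computes for every instance a solution of it, in a number of steps that is bounded by a
polynomial in the size of the input. -/
def SolvableInPolyTime {α : Type*} {β : α → Type*} (encIn : α → List ℕ)
    (encOut : ∀ a, β a → List ℕ) (Sol : ∀ a, β a → Prop) : Prop :=
  ∃ (P : Program) (p : Polynomial ℕ), ∀ a, ∃ b : β a,
    Sol a b ∧ OutputsInTime P (encIn a) (encOut a b) (p.eval (inputSize (encIn a)))

end RAM

/-! With requirements at most `2`, vector connectivity is a hitting-set condition. By Menger's
theorem for two paths, a vertex `v ∉ S` has a fan of order `2` iff `S` meets the component of `v`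
and, for every `x ≠ v`, the set `R(v, x)` of vertices joined to `v` in `G - x` (`isLinked_two_iff`).
If `x = n` is read as "nothing is deleted", `S` has to hit `R(v, x)` for all demands `(v, x)`.

Fix a vertex `ρ`. The sets `R(v, x)` inside the component of `ρ` that miss `ρ` form a laminar family
(`reachIn_laminar`). Let `T ∋ ρ` be a valid set from which no other vertex can be dropped. Each `h ≠
ρ` in `T` has a private set `R(v, x)`, which meets `T` only in `h`. In the component of `ρ` these
private sets miss `ρ`, hence are pairwise disjoint by laminarity, and a valid set containing `ρ`
needs a vertex other than `ρ` in each of them (`IsPruned.card_part_le`). So greedy deletion is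
optimal in a component once one vertex of an optimal solution there is guessed.

Components do not interact (`IsPruned.mem_iff`). Hence it suffices to try every `ρ` in turn, to
prune the current solution together with `ρ`, and to keep the result if it is smaller. This ends at
a minimum, because wherever an irredundant set has a vertex, every valid set has some vertex `ρ` in
the same component (`IsImprovedUpTo.card_le`).

The algorithm is written in a language whose loops all run `n` rounds, so a polynomial time bound
can be read off the syntax. `exec_compile` transfers meaning and cost to the RAM; correctness is
proved by loop invariants for `Cmd.eval`. -/

/-! ### Reachability inside a set of vertices -/

namespace VecCon

variable {V : Type*}

/-- `ReachIn G A a b`: some walk of `G` from `a` to `b` has all its vertices in `A`. -/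
inductive ReachIn (G : SimpleGraph V) (A : Set V) : V → V → Prop
  | refl {a : V} (ha : a ∈ A) : ReachIn G A a a
  | head {a c b : V} (ha : a ∈ A) (hac : G.Adj a c) (h : ReachIn G A c b) : ReachIn G A a b

namespace ReachIn

variable {G H : SimpleGraph V} {A B : Set V} {a b c : V}

theorem left_mem (h : ReachIn G A a b) : a ∈ A := by
  cases h <;> assumption

theorem right_mem (h : ReachIn G A a b) : b ∈ A := by
  induction h <;> assumption

theorem mono (hGH : G ≤ H) (hAB : A ⊆ B) (h : ReachIn G A a b) : ReachIn H B a b := by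
  induction h with
  | refl ha => exact .refl (hAB ha)
  | head ha hac _ ih => exact .head (hAB ha) (hGH hac) ih

theorem trans (h : ReachIn G A a b) (h' : ReachIn G A b c) : ReachIn G A a c := by
  induction h with
  | refl _ => exact h'
  | head ha hac _ ih => exact .head ha hac (ih h')

theorem tail (h : ReachIn G A a b) (hbc : G.Adj b c) (hc : c ∈ A) : ReachIn G A a c :=
  h.trans (.head h.right_mem hbc (.refl hc))

theorem symm (h : ReachIn G A a b) : ReachIn G A b a := by
  induction h with
  | refl ha => exact .refl ha
  | head ha hac _ ih => exact ih.tail hac.symm ha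

theorem of_walk (p : G.Walk a b) (hp : ∀ x ∈ p.support, x ∈ A) : ReachIn G A a b := by
  induction p with
  | nil => exact .refl (hp _ (by simp))
  | cons h p ih => exact .head (hp _ (by simp)) h (ih fun x hx => hp x (by simp [hx]))

theorem exists_walk (h : ReachIn G A a b) : ∃ p : G.Walk a b, ∀ x ∈ p.support, x ∈ A := by
  induction h with
  | refl ha => exact ⟨.nil, by simpa using ha⟩
  | head ha hac _ ih =>
    obtain ⟨p, hp⟩ := ih
    exact ⟨.cons hac p, by simpa using ⟨ha, hp⟩⟩

/-- The first edge of the walk that is missing from `H` starts at `x` or `y`; up to that point the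
walk runs in `H`. -/
theorem reachIn_or_of_forall_adj {x y : V}
    (hGH : ∀ u w, G.Adj u w → H.Adj u w ∨ u = x ∨ u = y) (h : ReachIn G A a b) :
    ReachIn H A a b ∨ ReachIn H A a x ∨ ReachIn H A a y := by
  induction h with
  | refl ha => exact .inl (.refl ha)
  | head ha hac _ ih =>
    rcases hGH _ _ hac with h | rfl | rfl
    · exact ih.imp (.head ha h) (Or.imp (.head ha h) (.head ha h))
    · exact .inr (.inl (.refl ha))
    · exact .inr (.inr (.refl ha))

/-- A walk that leaves `P` does so through `z` or along a missing edge at `x`; a missing edge at `y`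
is impossible because `y ∉ P`. -/
theorem exists_reachIn_of_closed {x y z : V} {P : Set V}
    (hGH : ∀ u w, G.Adj u w → H.Adj u w ∨ u = x ∨ u = y)
    (hP : ∀ u ∈ P, ∀ w, H.Adj u w → w ∈ insert z P) (hy : y ∉ P) (h : ReachIn G A a b)
    (hb : b ∉ P) (ha : a ∈ insert z P) : ∃ c ∈ ({z, x} : Set V), ReachIn H A a c := by
  induction h with
  | refl h => exact ⟨_, .inl (ha.resolve_right hb), .refl h⟩
  | head h hac _ ih =>
    rcases ha with rfl | ha
    · exact ⟨_, .inl rfl, .refl h⟩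
    rcases hGH _ _ hac with hac | rfl | rfl
    · obtain ⟨d, hd, h'⟩ := ih hb (hP _ ha _ hac)
      exact ⟨d, hd, .head h hac h'⟩
    · exact ⟨_, .inr rfl, .refl h⟩
    · exact absurd ha hy

/-- The walk is cut at its first visit to `z`; before that it has no exit from `P`. -/
theorem inter_insert_of_closed {z : V} {P : Set V}
    (hP : ∀ u ∈ P, ∀ w, G.Adj u w → w ∈ insert z P) (h : ReachIn G A a z)
    (ha : a ∈ insert z P) : ReachIn G (A ∩ insert z P) a z := by
  induction h with
  | refl h => exact .refl ⟨h, ha⟩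
  | head h hac h' ih =>
    rcases ha with rfl | ha
    · exact .refl ⟨h, .inl rfl⟩
    · exact .head ⟨h, .inr ha⟩ hac (ih hP (hP _ ha _ hac))

theorem inter_of_closed {z : V} {P : Set V}
    (hP : ∀ u ∈ P, ∀ w, G.Adj u w → w ∈ insert z P) (hz : z ∉ A) (h : ReachIn G A a b)
    (ha : a ∈ P) : ReachIn G (A ∩ P) a b := by
  induction h with
  | refl h => exact .refl ⟨h, ha⟩
  | head h hac h' ih =>
    refine .head ⟨h, ha⟩ hac (ih ((hP _ ha _ hac).resolve_left ?_))
    rintro rfl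
    exact hz h'.left_mem

end ReachIn

/-! ### Two disjoint connections -/

/-- Two disjoint sets of vertices such that one contains a walk from `X` to `z` and the other
a walk from `X` to `x`. -/
theorem exists_disjoint_reachIn_pair {H : SimpleGraph V} {X : Set V} {x z : V}
    (h : ∃ A B : Set V, Disjoint A B ∧ (∃ a ∈ X, ∃ b ∈ ({z, x} : Set V), ReachIn H A a b) ∧
      ∃ a ∈ X, ∃ b ∈ ({z, x} : Set V), ReachIn H B a b) :
    ∃ A B : Set V, Disjoint A B ∧ (∃ a ∈ X, ReachIn H A a z) ∧ ∃ a ∈ X, ReachIn H B a x := by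
  obtain ⟨A, B, hAB, ⟨a, ha, b, hb, hab⟩, ⟨a', ha', b', hb', hab'⟩⟩ := h
  have hne : b ≠ b' := by
    rintro rfl
    exact Set.disjoint_left.1 hAB hab.right_mem hab'.right_mem
  rcases hb with rfl | rfl <;> rcases hb' with rfl | rfl
  · exact absurd rfl hne
  · exact ⟨A, B, hAB, ⟨a, ha, hab⟩, a', ha', hab'⟩
  · exact ⟨B, A, hAB.symm, ⟨a', ha', hab'⟩, a, ha, hab⟩
  · exact absurd rfl hne

/-- Menger's theorem for two paths: if no single vertex separates `X` from `Y`, then there are two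
disjoint connections from `X` to `Y`. -/
theorem exists_disjoint_reachIn [Finite V] [Nonempty V] (G : SimpleGraph V) :
    ∀ X Y : Set V, (∀ z, ∃ a ∈ X, ∃ b ∈ Y, ReachIn G {z}ᶜ a b) →
      ∃ A B : Set V, Disjoint A B ∧ (∃ a ∈ X, ∃ b ∈ Y, ReachIn G A a b) ∧
        ∃ a ∈ X, ∃ b ∈ Y, ReachIn G B a b := by
  induction G using WellFoundedLT.induction with
  | ind G IH =>
  intro X Y hG
  by_cases hbot : ∀ x y, ¬ G.Adj x y
  · have key : ∀ z, ∃ a ∈ X, a ∈ Y ∧ a ≠ z := by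
      intro z
      obtain ⟨a, ha, b, hb, hab⟩ := hG z
      cases hab with
      | refl h => exact ⟨a, ha, hb, h⟩
      | head _ h _ => exact absurd h (hbot _ _)
    obtain ⟨a, haX, haY, -⟩ := key (Classical.arbitrary V)
    obtain ⟨b, hbX, hbY, hba⟩ := key a
    exact ⟨{a}, {b}, by simpa using hba.symm, ⟨a, haX, a, haY, .refl rfl⟩,
      b, hbX, b, hbY, .refl rfl⟩
  push Not at hbot
  obtain ⟨x₀, y₀, hxy₀⟩ := hbot
  set H := G.deleteEdges {s(x₀, y₀)} with hH
  have hHG : H ≤ G := G.deleteEdges_le _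
  have hlt : H < G := by
    refine lt_of_le_of_ne hHG fun h => ?_
    have : H.Adj x₀ y₀ := h ▸ hxy₀
    simp [hH] at this
  by_cases hHsep : ∀ z, ∃ a ∈ X, ∃ b ∈ Y, ReachIn H {z}ᶜ a b
  · obtain ⟨A, B, hAB, ⟨a, ha, b, hb, hab⟩, ⟨a', ha', b', hb', hab'⟩⟩ := IH H hlt X Y hHsep
    exact ⟨A, B, hAB, ⟨a, ha, b, hb, hab.mono hHG subset_rfl⟩,
      a', ha', b', hb', hab'.mono hHG subset_rfl⟩
  push Not at hHsep
  -- Here `z` separates `X` from `Y` in `H`; `P` and `Q` are the two sides.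
  obtain ⟨z, hz⟩ := hHsep
  set P : Set V := {u | ∃ a ∈ X, ReachIn H {z}ᶜ a u} with hPdef
  set Q : Set V := {u | ∃ b ∈ Y, ReachIn H {z}ᶜ b u} with hQdef
  have hPQ : ∀ u ∈ P, u ∉ Q := by
    rintro u ⟨a, ha, hau⟩ ⟨b, hb, hbu⟩
    exact hz a ha b hb (hau.trans hbu.symm)
  have hclosed : ∀ Z : Set V, ∀ u ∈ {u | ∃ a ∈ Z, ReachIn H {z}ᶜ a u}, ∀ w, H.Adj u w →
      w ∈ insert z {u | ∃ a ∈ Z, ReachIn H {z}ᶜ a u} := by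
    rintro Z u ⟨a, ha, hau⟩ w huw
    by_cases hw : w = z
    · exact .inl hw
    · exact .inr ⟨a, ha, hau.tail huw hw⟩
  have hstart : ∀ Z : Set V, ∀ a ∈ Z, a ∈ insert z {u | ∃ a ∈ Z, ReachIn H {z}ᶜ a u} := by
    intro Z a ha
    by_cases haz : a = z
    · exact .inl haz
    · exact .inr ⟨a, ha, .refl haz⟩
  have hGH₀ : ∀ u w, G.Adj u w → H.Adj u w ∨ u = x₀ ∨ u = y₀ := by
    intro u w huw
    by_cases h : s(u, w) = s(x₀, y₀)
    · right
      rw [Sym2.eq_iff] at h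
      tauto
    · left
      simpa [hH, huw] using h
  -- `z` does not separate `X` from `Y` in `G`, so the deleted edge runs from one side to the other.
  obtain ⟨x, y, hxy, hGH, hxP, hyQ⟩ : ∃ x y, G.Adj x y ∧
      (∀ u w, G.Adj u w → H.Adj u w ∨ u = x ∨ u = y) ∧ x ∈ P ∧ y ∈ Q := by
    obtain ⟨a, ha, b, hb, hab⟩ := hG z
    have h1 : x₀ ∈ P ∨ y₀ ∈ P :=
      ((hab.reachIn_or_of_forall_adj hGH₀).resolve_left (hz a ha b hb)).imp
        (fun h => ⟨a, ha, h⟩) fun h => ⟨a, ha, h⟩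
    have h2 : x₀ ∈ Q ∨ y₀ ∈ Q :=
      ((hab.symm.reachIn_or_of_forall_adj hGH₀).resolve_left
        fun h => hz a ha b hb h.symm).imp (fun h => ⟨b, hb, h⟩) fun h => ⟨b, hb, h⟩
    rcases h1 with h1 | h1 <;> rcases h2 with h2 | h2
    · exact absurd h2 (hPQ _ h1)
    · exact ⟨x₀, y₀, hxy₀, hGH₀, h1, h2⟩
    · exact ⟨y₀, x₀, hxy₀.symm, fun u w h => (hGH₀ u w h).imp_right Or.symm, h1, h2⟩
    · exact absurd h2 (hPQ _ h1)
  -- No vertex `t` separates `X` from `{z, x}` in `H`: a walk of `G` from `X` to `Y` that avoids `t`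
  -- ends outside `P`, so it reaches `z` or `x` within `H`.
  obtain ⟨A₁, A₂, hA, ⟨a₁, ha₁, hA₁⟩, ⟨a₂, ha₂, hA₂⟩⟩ :=
    exists_disjoint_reachIn_pair (IH H hlt X {z, x} fun t => by
      obtain ⟨a, ha, b, hb, hab⟩ := hG t
      have hbP : b ∉ P := by
        intro hbP
        obtain ⟨a', ha', h⟩ := hbP
        exact hz a' ha' b hb h
      exact ⟨a, ha, hab.exists_reachIn_of_closed hGH (hclosed X)
        (fun h => hPQ _ h hyQ) hbP (hstart X a ha)⟩)
  obtain ⟨B₁, B₂, hB, ⟨b₁, hb₁, hB₁⟩, ⟨b₂, hb₂, hB₂⟩⟩ :=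
    exists_disjoint_reachIn_pair (IH H hlt Y {z, y} fun t => by
      obtain ⟨a, ha, b, hb, hab⟩ := hG t
      have haQ : a ∉ Q := by
        intro haQ
        obtain ⟨b', hb', h⟩ := haQ
        exact hz a ha b' hb' h.symm
      exact ⟨b, hb, hab.symm.exists_reachIn_of_closed
        (fun u w h => (hGH u w h).imp_right Or.symm) (hclosed Y)
        (fun h => hPQ _ hxP h) haQ (hstart Y b hb)⟩)
  have hzA : z ∉ A₂ := Set.disjoint_left.1 hA hA₁.right_mem
  have hzB : z ∉ B₂ := Set.disjoint_left.1 hB hB₁.right_mem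
  have ha₂P : a₂ ∈ P := (hstart X a₂ ha₂).resolve_left fun h => hzA (h ▸ hA₂.left_mem)
  have hb₂Q : b₂ ∈ Q := (hstart Y b₂ hb₂).resolve_left fun h => hzB (h ▸ hB₂.left_mem)
  have r₁ := hA₁.inter_insert_of_closed (hclosed X) (hstart X a₁ ha₁)
  have r₂ := hA₂.inter_of_closed (hclosed X) hzA ha₂P
  have s₁ := hB₁.inter_insert_of_closed (hclosed Y) (hstart Y b₁ hb₁)
  have s₂ := hB₂.inter_of_closed (hclosed Y) hzB hb₂Q
  -- Two connections are glued at `z`, the other two along the edge `xy`. Cutting them down to the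
  -- sides `P` and `Q` makes the results disjoint.
  refine ⟨(A₁ ∩ insert z P) ∪ (B₁ ∩ insert z Q), (A₂ ∩ P) ∪ (B₂ ∩ Q), ?_,
    ⟨a₁, ha₁, b₁, hb₁, (r₁.mono hHG Set.subset_union_left).trans
      (s₁.symm.mono hHG Set.subset_union_right)⟩,
    ⟨a₂, ha₂, b₂, hb₂, (r₂.mono hHG Set.subset_union_left).trans
      (.head (.inl r₂.right_mem) hxy (s₂.symm.mono hHG Set.subset_union_right))⟩⟩
  rw [Set.disjoint_left] at hA hB ⊢
  rintro u (⟨h1, rfl | h2⟩ | ⟨h1, rfl | h2⟩) (⟨h3, h4⟩ | ⟨h3, h4⟩)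
  · exact hA h1 h3
  · exact hzB h3
  · exact hA h1 h3
  · exact hPQ _ h2 h4
  · exact hzA h3
  · exact hB h1 h3
  · exact hPQ _ h4 h2
  · exact hB h1 h3

/-! ### Fans of order at most two -/

theorem isLinked_zero (G : SimpleGraph V) (v : V) (S : Set V) : IsLinked G 0 v S :=
  ⟨fun i => i.elim0, fun i => i.elim0, fun i => i.elim0, fun i => i.elim0⟩

theorem isLinked_one_iff {G : SimpleGraph V} {v : V} {S : Set V} :
    IsLinked G 1 v S ↔ ∃ s ∈ S, ReachIn G Set.univ v s := by
  classical
  constructor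
  · rintro ⟨w, p, hw, -⟩
    exact ⟨w 0, hw 0, .of_walk (p 0).1 fun _ _ => trivial⟩
  · rintro ⟨s, hs, h⟩
    obtain ⟨p, -⟩ := h.exists_walk
    exact ⟨fun _ => s, fun _ => p.toPath, fun _ => hs,
      fun i j hij => absurd (Subsingleton.elim i j) hij⟩

/-- The graph `G` with all edges at `v` removed. -/
def isolate (G : SimpleGraph V) (v : V) : SimpleGraph V where
  Adj a b := G.Adj a b ∧ a ≠ v ∧ b ≠ v
  symm := ⟨fun _ _ h => ⟨h.1.symm, h.2.2, h.2.1⟩⟩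
  loopless := ⟨fun _ h => h.1.ne rfl⟩

theorem isolate_le (G : SimpleGraph V) (v : V) : isolate G v ≤ G := fun _ _ h => h.1

theorem ReachIn.inter_compl_of_isolate {G : SimpleGraph V} {A : Set V} {v a b : V}
    (h : ReachIn (isolate G v) A a b) (ha : a ≠ v) :
    ReachIn (isolate G v) (A ∩ {v}ᶜ) a b := by
  induction h with
  | refl h => exact .refl ⟨h, ha⟩
  | head h hac _ ih => exact .head ⟨h, ha⟩ hac (ih hac.2.2)

theorem ReachIn.isolate_or {G : SimpleGraph V} {A : Set V} {v a b : V}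
    (h : ReachIn G A a b) (hb : b ≠ v) :
    (a ≠ v ∧ ReachIn (isolate G v) A a b) ∨ ∃ w, G.Adj v w ∧ ReachIn (isolate G v) A w b := by
  induction h with
  | refl h => exact .inl ⟨hb, .refl h⟩
  | @head a c b h hac _ ih =>
    rcases ih hb with ⟨hc, ih⟩ | ih
    · by_cases ha : a = v
      · exact .inr ⟨c, ha ▸ hac, ih⟩
      · exact .inl ⟨ha, .head h ⟨hac, ha, hc⟩ ih⟩
    · exact .inr ih

theorem ReachIn.exists_path_of_adj {G : SimpleGraph V} {A : Set V} {v a b : V}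
    (h : ReachIn G A a b) (hva : G.Adj v a) :
    ∃ p : G.Path v b, ∀ x ∈ (p : G.Walk v b).support, x = v ∨ x ∈ A := by
  classical
  obtain ⟨p, hp⟩ := h.exists_walk
  refine ⟨(SimpleGraph.Walk.cons hva p).toPath, fun x hx => ?_⟩
  have := SimpleGraph.Walk.support_toPath_subset_support _ hx
  simp only [SimpleGraph.Walk.support_cons, List.mem_cons] at this
  exact this.imp_right (hp x)

/-- Conversely to the fact that `x ≠ v` lies on at most one of the two paths, Menger's theorem is
applied from the neighbours of `v` to `S` in `isolate G v`. A separating vertex other than `v` is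
excluded by the second condition, and `v` itself by the first. -/
theorem isLinked_two_iff [Finite V] {G : SimpleGraph V} {v : V} {S : Set V} (hv : v ∉ S) :
    IsLinked G 2 v S ↔ (∃ s ∈ S, ReachIn G Set.univ v s) ∧
      ∀ x, x ≠ v → ∃ s ∈ S, ReachIn G {x}ᶜ v s := by
  constructor
  · rintro ⟨w, p, hw, hp⟩
    refine ⟨⟨w 0, hw 0, .of_walk (p 0).1 fun _ _ => trivial⟩, fun x hx => ?_⟩
    have h01 := hp 0 1 (by decide)
    by_cases h0 : x ∈ (p 0 : G.Walk v (w 0)).support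
    · have h1 : x ∉ (p 1 : G.Walk v (w 1)).support := by
        intro h1
        have : x ∈ ({v} : Set V) := h01 ▸ ⟨h0, h1⟩
        exact hx this
      exact ⟨w 1, hw 1, .of_walk (p 1).1 fun y hy hyx => h1 (hyx ▸ hy)⟩
    · exact ⟨w 0, hw 0, .of_walk (p 0).1 fun y hy hyx => h0 (hyx ▸ hy)⟩
  · rintro ⟨h1, h2⟩
    have key : ∀ A : Set V, (∃ s ∈ S, ReachIn G A v s) →
        ∃ a ∈ {a | G.Adj v a}, ∃ b ∈ S, ReachIn (isolate G v) A a b := by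
      rintro A ⟨s, hs, h⟩
      rcases h.isolate_or (v := v) (by rintro rfl; exact hv hs) with h | ⟨w, hw, h⟩
      · exact absurd rfl h.1
      · exact ⟨w, hw, s, hs, h⟩
    have : Nonempty V := ⟨v⟩
    obtain ⟨A, B, hAB, ⟨a, ha, s, hs, hA⟩, ⟨b, hb, t, ht, hB⟩⟩ :=
      exists_disjoint_reachIn (isolate G v) {a | G.Adj v a} S fun z => by
        by_cases hz : z = v
        · obtain ⟨a, ha, b, hb, h⟩ := key _ h1
          refine ⟨a, ha, b, hb, (h.inter_compl_of_isolate (SimpleGraph.Adj.ne' ha)).mono le_rfl ?_⟩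
          rw [hz]
          exact Set.inter_subset_right
        · exact key _ (h2 z hz)
    obtain ⟨p, hp⟩ := ((hA.inter_compl_of_isolate (SimpleGraph.Adj.ne' ha)).mono
      (isolate_le G v) subset_rfl).exists_path_of_adj ha
    obtain ⟨q, hq⟩ := ((hB.inter_compl_of_isolate (SimpleGraph.Adj.ne' hb)).mono
      (isolate_le G v) subset_rfl).exists_path_of_adj hb
    have hpq : {x | x ∈ (p : G.Walk v s).support} ∩ {x | x ∈ (q : G.Walk v t).support} = {v} := by
      ext x
      constructor
      · rintro ⟨hx, hx'⟩
        rcases hp x hx with h | h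
        · exact h
        rcases hq x hx' with h' | h'
        · exact h'
        exact absurd h'.1 (Set.disjoint_left.1 hAB h.1)
      · rintro rfl
        exact ⟨SimpleGraph.Walk.start_mem_support _, SimpleGraph.Walk.start_mem_support _⟩
    refine ⟨![s, t], fun i => match i with | 0 => p | 1 => q, ?_, ?_⟩
    · intro i
      fin_cases i <;> simpa
    · intro i j hij
      fin_cases i <;> fin_cases j
      · exact absurd rfl hij
      · exact hpq
      · rw [Set.inter_comm]; exact hpq
      · exact absurd rfl hij

end VecCon

/-! ### Vector connectivity sets as hitting sets -/

namespace VecCon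

theorem ReachIn.connectedComponentMk_eq {V : Type*} {G : SimpleGraph V} {A : Set V} {a b : V}
    (h : ReachIn G A a b) : G.connectedComponentMk a = G.connectedComponentMk b := by
  obtain ⟨p, -⟩ := h.exists_walk
  exact SimpleGraph.ConnectedComponent.eq.2 ⟨p⟩

theorem ReachIn.of_connectedComponentMk_eq {V : Type*} {G : SimpleGraph V} {a b : V}
    (h : G.connectedComponentMk a = G.connectedComponentMk b) : ReachIn G Set.univ a b := by
  obtain ⟨p⟩ := SimpleGraph.ConnectedComponent.eq.1 h
  exact .of_walk p fun _ _ => trivial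

theorem ReachIn.of_forall_mem {V : Type*} {G : SimpleGraph V} {A B : Set V} {a b : V}
    (h : ReachIn G A a b) (hB : ∀ c, ReachIn G A a c → c ∈ B) : ReachIn G B a b := by
  induction h with
  | refl h => exact .refl (hB _ (.refl h))
  | head h hac _ ih =>
    exact .head (hB _ (.refl h)) hac (ih fun c hc => hB c (.head h hac hc))

variable {n : ℕ} {G : SimpleGraph (Fin n)} {r : Fin n → ℕ}

/-- All vertices except `x`, or all vertices if `x` is not smaller than `n`. -/
def avoid (n x : ℕ) : Set (Fin n) := {w | (w : ℕ) ≠ x}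

/-- The requirement of `v` asks for a connection from `v` to the solution that avoids `x`. -/
def Demand (r : Fin n → ℕ) (v : Fin n) (x : ℕ) : Prop :=
  (v : ℕ) ≠ x ∧ (if x < n then 2 else 1) ≤ r v

/-- `S` meets all demands. -/
def Valid (G : SimpleGraph (Fin n)) (r : Fin n → ℕ) (S : Finset (Fin n)) : Prop :=
  ∀ v x, Demand r v x → ∃ s ∈ S, ReachIn G (avoid n x) v s

theorem avoid_of_le {x : ℕ} (hx : n ≤ x) : avoid n x = Set.univ :=
  Set.eq_univ_of_forall fun w => (w.2.trans_le hx).ne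

theorem avoid_val (x : Fin n) : avoid n x = {x}ᶜ := by
  ext w
  simp [avoid, Fin.ext_iff]

/-- A vertex of `S` meets its own demands, so `Valid` needs no exception for it. The values `x ≥ n`
delete nothing and account for plain reachability. -/
theorem isVectorConnectivitySet_iff_valid (hr : ∀ v, r v ≤ 2) (S : Finset (Fin n)) :
    IsVectorConnectivitySet G r (S : Set (Fin n)) ↔ Valid G r S := by
  constructor
  · rintro h v x ⟨hvx, hx⟩
    by_cases hv : v ∈ S
    · exact ⟨v, hv, .refl hvx⟩
    have hl := h v (by simpa using hv)
    split_ifs at hx with hxn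
    · rw [le_antisymm (hr v) hx, isLinked_two_iff (by simpa using hv)] at hl
      have := hl.2 ⟨x, hxn⟩ (by rintro rfl; exact hvx rfl)
      rw [← avoid_val] at this
      exact this
    · rw [avoid_of_le (not_lt.1 hxn)]
      rcases (show r v = 1 ∨ r v = 2 by have := hr v; omega) with h1 | h2
      · rw [h1, isLinked_one_iff] at hl
        exact hl
      · rw [h2, isLinked_two_iff (by simpa using hv)] at hl
        exact hl.1
  · intro h v hv
    have h1 : 1 ≤ r v → ∃ s ∈ (S : Set (Fin n)), ReachIn G Set.univ v s := by
      intro h1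
      have := h v n ⟨v.2.ne, by simpa using h1⟩
      rwa [avoid_of_le le_rfl] at this
    rcases (show r v = 0 ∨ r v = 1 ∨ r v = 2 by have := hr v; omega) with h0 | h0 | h0
    · rw [h0]
      exact isLinked_zero _ _ _
    · rw [h0, isLinked_one_iff]
      exact h1 h0.ge
    · rw [h0, isLinked_two_iff hv]
      refine ⟨h1 (by omega), fun x hx => ?_⟩
      have := h v x ⟨fun h => hx (Fin.ext h).symm, by simpa using h0.ge⟩
      rwa [avoid_val] at this

theorem Valid.mono {S T : Finset (Fin n)} (h : Valid G r S) (hST : S ⊆ T) : Valid G r T := by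
  intro v x hv
  obtain ⟨s, hs, h⟩ := h v x hv
  exact ⟨s, hST hs, h⟩

theorem valid_univ : Valid G r Finset.univ :=
  fun v _ hv => ⟨v, Finset.mem_univ v, .refl hv.1⟩

/-- The sets of vertices reachable under demands that do not contain a given vertex of the same
component form a laminar family. -/
theorem reachIn_laminar {x y : ℕ} {o u v ρ : Fin n} (hv : ReachIn G (avoid n x) v o)
    (hu : ReachIn G (avoid n y) u o) (hvρ : ¬ ReachIn G (avoid n x) v ρ)
    (huρ : ¬ ReachIn G (avoid n y) u ρ)
    (hoρ : G.connectedComponentMk o = G.connectedComponentMk ρ) :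
    (∀ w, ReachIn G (avoid n x) v w → ReachIn G (avoid n y) u w) ∨
      ∀ w, ReachIn G (avoid n y) u w → ReachIn G (avoid n x) v w := by
  -- If the set of `u` does not contain `x`, all of it is joined to `v` through `o` without `x`. The
  -- case of `y` is symmetric.
  by_cases hx : ∀ w, ReachIn G (avoid n y) u w → (w : ℕ) ≠ x
  · right
    intro w hw
    exact hv.trans ((hu.symm.trans hw).of_forall_mem fun c hc => hx c (hu.trans hc))
  by_cases hy : ∀ w, ReachIn G (avoid n x) v w → (w : ℕ) ≠ y
  · left
    intro w hw
    exact hu.trans ((hv.symm.trans hw).of_forall_mem fun c hc => hy c (hv.trans hc))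
  push Not at hx hy
  obtain ⟨a, ha, hax⟩ := hx
  obtain ⟨b, hb, hby⟩ := hy
  -- Now `a` is the vertex `x` and lies in the set of `u`, and `b` is the vertex `y` and lies in the
  -- set of `v`. Following a walk to `a` backwards, each vertex stays joined to `a` without `y` or
  -- to `b` without `x`, the two alternatives switching at `x` and `y`. For `ρ` both alternatives
  -- are excluded.
  have key : ∀ c, ReachIn G Set.univ c a →
      ReachIn G (avoid n y) c a ∨ ReachIn G (avoid n x) c b := by
    intro c hc
    induction hc with
    | refl _ => exact .inl (.refl ha.right_mem)
    | @head d e _ _ hde _ ih =>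
      rcases ih ha hax with ih | ih
      · by_cases hd : (d : ℕ) = y
        · rw [show d = b from Fin.ext (hd.trans hby.symm)]
          exact .inr (.refl hb.right_mem)
        · exact .inl (.head hd hde ih)
      · by_cases hd : (d : ℕ) = x
        · rw [Fin.ext (hd.trans hax.symm)]
          exact .inl (.refl ha.right_mem)
        · exact .inr (.head hd hde ih)
  rcases key ρ (.of_connectedComponentMk_eq
    (hoρ.symm.trans (hu.symm.trans ha).connectedComponentMk_eq)) with h | h
  · exact absurd (ha.trans h.symm) huρ
  · exact absurd (hb.trans h.symm) hvρ

/-- `T` arises from `S ∪ {ρ}` by removing redundant vertices other than `ρ`; here `ρ` may also be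
a number that is not a vertex. -/
structure IsPruned (G : SimpleGraph (Fin n)) (r : Fin n → ℕ) (S : Finset (Fin n)) (ρ : ℕ)
    (T : Finset (Fin n)) : Prop where
  valid : Valid G r T
  mem_or_eq : ∀ t ∈ T, t ∈ S ∨ (t : ℕ) = ρ
  mem_of_eq : ∀ t : Fin n, (t : ℕ) = ρ → t ∈ T
  not_valid_erase : ∀ t ∈ T, (t : ℕ) ≠ ρ → ¬ Valid G r (T.erase t)

/-- The part of `S` in the connected component `c`. -/
noncomputable def part (G : SimpleGraph (Fin n)) (S : Finset (Fin n)) (c : G.ConnectedComponent) :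
    Finset (Fin n) := by
  classical exact S.filter fun v => G.connectedComponentMk v = c

theorem mem_part {S : Finset (Fin n)} {c : G.ConnectedComponent} {v : Fin n} :
    v ∈ part G S c ↔ v ∈ S ∧ G.connectedComponentMk v = c := by
  simp [part]

theorem exists_private_demand {T : Finset (Fin n)} {h : Fin n} (hT : Valid G r T)
    (hh : ¬ Valid G r (T.erase h)) : ∃ v x, Demand r v x ∧ ReachIn G (avoid n x) v h ∧
      ∀ s ∈ T, s ≠ h → ¬ ReachIn G (avoid n x) v s := by
  simp only [Valid, not_forall, not_exists, not_and] at hh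
  obtain ⟨v, x, hd, hvx⟩ := hh
  have hpriv : ∀ s ∈ T, s ≠ h → ¬ ReachIn G (avoid n x) v s :=
    fun s hs hsh => hvx s (Finset.mem_erase.2 ⟨hsh, hs⟩)
  obtain ⟨s, hs, hvs⟩ := hT v x hd
  have hsh : s = h := by
    by_contra hne
    exact hpriv s hs hne hvs
  exact ⟨v, x, hd, hsh ▸ hvs, hpriv⟩

/-- Within the component of `ρ`, a pruned set is smallest among the valid sets that contain `ρ`. -/
theorem IsPruned.card_part_le {S T O : Finset (Fin n)} {ρ : Fin n} (hT : IsPruned G r S ρ T)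
    (hO : Valid G r O) (hρO : ρ ∈ O) :
    (part G T (G.connectedComponentMk ρ)).card ≤ (part G O (G.connectedComponentMk ρ)).card := by
  have hρT : ρ ∈ T := hT.mem_of_eq ρ rfl
  -- `ρ` is matched with itself, any other `h` with the vertices of `O` in a reachable set private
  -- to `h`. If some `o` had two partners, laminarity would put both into the private set of one of
  -- them.
  refine Finset.card_le_card_of_forall_subsingleton
    (fun h o => (h = ρ ∧ o = ρ) ∨ (h ≠ ρ ∧ o ≠ ρ ∧ ∃ v x, ReachIn G (avoid n x) v h ∧
      ReachIn G (avoid n x) v o ∧ ∀ s ∈ T, s ≠ h → ¬ ReachIn G (avoid n x) v s)) ?_ ?_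
  · intro h hh
    rw [mem_part] at hh
    by_cases hhρ : h = ρ
    · exact ⟨ρ, mem_part.2 ⟨hρO, rfl⟩, .inl ⟨hhρ, rfl⟩⟩
    · obtain ⟨v, x, hd, hvh, hpriv⟩ := exists_private_demand hT.valid
        (hT.not_valid_erase h hh.1 fun h' => hhρ (Fin.ext h'))
      obtain ⟨o, ho, hvo⟩ := hO v x hd
      refine ⟨o, mem_part.2 ⟨ho, ?_⟩, .inr ⟨hhρ, ?_, v, x, hvh, hvo, hpriv⟩⟩
      · rw [← hh.2]
        exact (hvo.symm.trans hvh).connectedComponentMk_eq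
      · rintro rfl
        exact hpriv o hρT (Ne.symm hhρ) hvo
  · rintro o ho h ⟨hh, hho⟩ h' ⟨hh', hho'⟩
    rw [mem_part] at ho hh hh'
    rcases hho with ⟨rfl, rfl⟩ | ⟨hhρ, hoρ, v, x, hvh, hvo, hpriv⟩ <;>
      rcases hho' with ⟨rfl, h1⟩ | ⟨hhρ', hoρ', v', x', hvh', hvo', hpriv'⟩
    · rfl
    · exact absurd rfl hoρ'
    · exact absurd h1 hoρ
    by_contra hne
    rcases reachIn_laminar hvo hvo' (hpriv ρ hρT (Ne.symm hhρ)) (hpriv' ρ hρT (Ne.symm hhρ'))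
      ho.2 with hl | hl
    · exact hpriv' h hh.1 hne (hl h hvh)
    · exact hpriv h' hh'.1 (Ne.symm hne) (hl h' hvh')

/-- `S` is valid and has no redundant vertex. -/
def IsIrredundant (G : SimpleGraph (Fin n)) (r : Fin n → ℕ) (S : Finset (Fin n)) : Prop :=
  Valid G r S ∧ ∀ s ∈ S, ¬ Valid G r (S.erase s)

/-! ### Independence of the components and the improvement step -/

/-- Outside the component of `ρ`, `T` only loses vertices of `S`. If it lost `w`, then `S` without
`w` would be valid: `T` meets the demands in the component of `w` by vertices of `S`, and `S` meets
the others by vertices outside that component. This contradicts irredundance. -/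
theorem IsPruned.mem_iff {S T : Finset (Fin n)} {ρ w : Fin n} (hT : IsPruned G r S ρ T)
    (hS : IsIrredundant G r S) (hw : G.connectedComponentMk w ≠ G.connectedComponentMk ρ) :
    w ∈ T ↔ w ∈ S := by
  have hTS : ∀ t ∈ T, G.connectedComponentMk t ≠ G.connectedComponentMk ρ → t ∈ S := by
    intro t ht hne
    refine (hT.mem_or_eq t ht).resolve_right fun h => hne ?_
    rw [Fin.ext h]
  refine ⟨fun h => hTS w h hw, fun hwS => ?_⟩
  by_contra hwT
  refine hS.2 w hwS fun v x hd => ?_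
  by_cases hvw : G.connectedComponentMk v = G.connectedComponentMk w
  · obtain ⟨t, ht, hvt⟩ := hT.valid v x hd
    refine ⟨t, Finset.mem_erase.2 ⟨fun h => hwT (h ▸ ht), hTS t ht ?_⟩, hvt⟩
    rw [← hvt.connectedComponentMk_eq, hvw]
    exact hw
  · obtain ⟨s, hs, hvs⟩ := hS.1 v x hd
    refine ⟨s, Finset.mem_erase.2 ⟨?_, hs⟩, hvs⟩
    rintro rfl
    exact hvw hvs.connectedComponentMk_eq

theorem IsPruned.part_eq {S T : Finset (Fin n)} {ρ : Fin n} {c : G.ConnectedComponent}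
    (hT : IsPruned G r S ρ T) (hS : IsIrredundant G r S) (hc : c ≠ G.connectedComponentMk ρ) :
    part G T c = part G S c := by
  ext w
  simp only [mem_part]
  exact and_congr_left fun h => hT.mem_iff hS (h ▸ hc)

theorem sum_card_part (G : SimpleGraph (Fin n)) (S : Finset (Fin n)) :
    let _ := Fintype.ofFinite G.ConnectedComponent
    ∑ c, (part G S c).card = S.card := by
  classical
  let _ := Fintype.ofFinite G.ConnectedComponent
  rw [Finset.card_eq_sum_card_fiberwise (f := G.connectedComponentMk) (t := Finset.univ)
    (fun _ _ => Finset.mem_coe.2 (Finset.mem_univ _))]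
  refine Finset.sum_congr rfl fun c _ => ?_
  congr 1

theorem IsPruned.card_add_card_part {S T : Finset (Fin n)} {ρ : Fin n}
    (hT : IsPruned G r S ρ T) (hS : IsIrredundant G r S) :
    T.card + (part G S (G.connectedComponentMk ρ)).card =
      S.card + (part G T (G.connectedComponentMk ρ)).card := by
  classical
  let _ := Fintype.ofFinite G.ConnectedComponent
  have h := fun U : Finset (Fin n) => (sum_card_part G U).symm.trans
    (Finset.add_sum_erase _ _ (Finset.mem_univ (G.connectedComponentMk ρ))).symm
  have hrest : ∑ c ∈ Finset.univ.erase (G.connectedComponentMk ρ), (part G T c).card =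
      ∑ c ∈ Finset.univ.erase (G.connectedComponentMk ρ), (part G S c).card :=
    Finset.sum_congr rfl fun c hc => by rw [hT.part_eq hS (Finset.ne_of_mem_erase hc)]
  have h1 := h T
  have h2 := h S
  omega

/-- `S` is irredundant, and in the component of every vertex `ρ < k` it is at most as large as any
valid set that contains `ρ`. -/
def IsImprovedUpTo (G : SimpleGraph (Fin n)) (r : Fin n → ℕ) (k : ℕ) (S : Finset (Fin n)) :
    Prop :=
  IsIrredundant G r S ∧ ∀ ρ : Fin n, (ρ : ℕ) < k → ∀ O, Valid G r O → ρ ∈ O →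
    (part G S (G.connectedComponentMk ρ)).card ≤ (part G O (G.connectedComponentMk ρ)).card

/-- The smaller one of `S` and `T`, and `S` if they have equal size. -/
def smaller (S T : Finset (Fin n)) : Finset (Fin n) := if T.card < S.card then T else S

/-- Since `n` is not a vertex, no vertex is protected, and pruning yields an irredundant set. -/
theorem IsPruned.isImprovedUpTo_zero {T : Finset (Fin n)}
    (hT : IsPruned G r Finset.univ n T) : IsImprovedUpTo G r 0 (smaller Finset.univ T) := by
  have hirr : IsIrredundant G r T := ⟨hT.valid, fun t ht => hT.not_valid_erase t ht t.2.ne⟩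
  refine ⟨?_, fun ρ h => absurd h (Nat.not_lt_zero _)⟩
  unfold smaller
  split_ifs with h
  · exact hirr
  · rwa [← Finset.eq_univ_of_card T (le_antisymm (Finset.card_le_univ T) (not_lt.1 h))]

/-- `S` and `T` agree outside the component of `ρ`, so comparing their sizes compares their parts
there, and no part grows. -/
theorem IsPruned.isImprovedUpTo_succ {S T : Finset (Fin n)} {ρ : Fin n}
    (hT : IsPruned G r S ρ T) (hS : IsImprovedUpTo G r ρ S) :
    IsImprovedUpTo G r (ρ + 1) (smaller S T) := by
  obtain ⟨hirr, himp⟩ := hS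
  have hcard := hT.card_add_card_part hirr
  have hle : ∀ c, (part G (smaller S T) c).card ≤ (part G S c).card := by
    intro c
    unfold smaller
    split_ifs with h
    · by_cases hc : c = G.connectedComponentMk ρ
      · subst hc
        omega
      · rw [hT.part_eq hirr hc]
    · exact le_rfl
  refine ⟨?_, fun σ hσ O hO hσO => ?_⟩
  · unfold smaller
    split_ifs with h
    · refine ⟨hT.valid, fun t ht hval => ?_⟩
      -- Pruning never tests `ρ` itself. If `ρ` were redundant, `T` without `ρ` would be a valid
      -- subset of `S`, hence equal to `S`, although `T` is smaller than `S`.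
      by_cases htρ : (t : ℕ) = ρ
      · obtain rfl : t = ρ := Fin.ext htρ
        have hsub : T.erase t ⊆ S := by
          intro w hw
          obtain ⟨hwt, hwT⟩ := Finset.mem_erase.1 hw
          exact (hT.mem_or_eq w hwT).resolve_right fun h' => hwt (Fin.ext h')
        by_cases hsub' : S ⊆ T.erase t
        · exact absurd (Finset.card_le_card (hsub'.trans (Finset.erase_subset _ _))) h.not_ge
        · obtain ⟨s, hs, hsT⟩ := Finset.not_subset.1 hsub'
          exact hirr.2 s hs (hval.mono fun w hw =>
            Finset.mem_erase.2 ⟨fun h' => hsT (h' ▸ hw), hsub hw⟩)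
      · exact hT.not_valid_erase t ht htρ hval
    · exact hirr
  · rcases Nat.lt_succ_iff_lt_or_eq.1 hσ with hlt | heq
    · exact (hle _).trans (himp σ hlt O hO hσO)
    · obtain rfl : σ = ρ := Fin.ext heq
      have := hT.card_part_le hO hσO
      unfold smaller
      split_ifs with h <;> omega

/-- A vertex of `S` in `c` has a private demand, which `O` meets by some `o` in `c`; the bound for
`ρ = o` then applies. -/
theorem IsImprovedUpTo.card_le {S O : Finset (Fin n)} (hS : IsImprovedUpTo G r n S)
    (hO : Valid G r O) : S.card ≤ O.card := by
  let _ := Fintype.ofFinite G.ConnectedComponent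
  rw [← sum_card_part G S, ← sum_card_part G O]
  refine Finset.sum_le_sum fun c _ => ?_
  rcases (part G S c).eq_empty_or_nonempty with h | ⟨s, hs⟩
  · simp [h]
  obtain ⟨hsS, rfl⟩ := mem_part.1 hs
  obtain ⟨v, x, hd, hvs, -⟩ := exists_private_demand hS.1.1 (hS.1.2 s hsS)
  obtain ⟨o, ho, hvo⟩ := hO v x hd
  rw [(hvs.symm.trans hvo).connectedComponentMk_eq]
  exact hS.2 o o.2 O hO ho

theorem IsImprovedUpTo.isMinVectorConnectivitySet {S : Finset (Fin n)}
    (hS : IsImprovedUpTo G r n S) (hr : ∀ v, r v ≤ 2) : IsMinVectorConnectivitySet G r S :=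
  ⟨(isVectorConnectivitySet_iff_valid hr S).2 hS.1.1,
    fun S' hS' => hS.card_le ((isVectorConnectivitySet_iff_valid hr S').1 hS')⟩

end VecCon

/-! ### Loop programs

A small language with counting loops whose programs are translated to RAM programs.  Every loop
runs through `0, …, n - 1` for a fixed number `n`, so that the running time is bounded by a
polynomial in `n`. -/

namespace RAM

/-- Loop programs use registers, the arrays `0`, `1`, `2`, and array `3`, which occupies the cells
of the input. -/
inductive Cmd
  | const (d c : ℕ)
  | size (d : ℕ)
  | add (d a b : ℕ)
  | sub (d a b : ℕ)
  | load (d : ℕ) (A : Fin 3) (i : ℕ)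
  | store (A : Fin 3) (i b : ℕ)
  | get (d i : ℕ)
  | put (i b : ℕ)
  | seq (P Q : Cmd)
  | ite (a : ℕ) (P Q : Cmd)
  | loop (i : ℕ) (P : Cmd)

/-- The configurations of loop programs. -/
@[ext]
structure Store where
  reg : ℕ → ℕ
  arr : ℕ → ℕ → ℕ

namespace Store

def setReg (s : Store) (d x : ℕ) : Store :=
  { s with reg := fun k => if k = d then x else s.reg k }

def setArr (s : Store) (A i x : ℕ) : Store :=
  { s with arr := fun B j => if B = A ∧ j = i then x else s.arr B j }

@[simp] theorem reg_setReg (s : Store) (d x k : ℕ) :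
    (s.setReg d x).reg k = if k = d then x else s.reg k := rfl

@[simp] theorem arr_setReg (s : Store) (d x : ℕ) : (s.setReg d x).arr = s.arr := rfl

@[simp] theorem reg_setArr (s : Store) (A i x : ℕ) : (s.setArr A i x).reg = s.reg := rfl

@[simp] theorem arr_setArr (s : Store) (A i x B j : ℕ) :
    (s.setArr A i x).arr B j = if B = A ∧ j = i then x else s.arr B j := rfl

/-- The initial configuration for the input `x`. -/
def init (x : List ℕ) : Store where
  reg _ := 0
  arr A i := if A = 3 then x.getD i 0 else 0

end Store

namespace Cmd

/-- The semantics of loop programs with loop bound `n` on inputs of length `D`. -/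
def eval (n D : ℕ) : Cmd → Store → Store
  | const d c, s => s.setReg d c
  | size d, s => s.setReg d n
  | add d a b, s => s.setReg d (s.reg a + s.reg b)
  | sub d a b, s => s.setReg d (s.reg a - s.reg b)
  | load d A i, s => s.setReg d (s.arr A (s.reg i))
  | store A i b, s => s.setArr A (s.reg i) (s.reg b)
  | get d i, s => s.setReg d (if s.reg i < D then s.arr 3 (s.reg i) else 0)
  | put i b, s => if s.reg i < D then s.setArr 3 (s.reg i) (s.reg b) else s
  | seq P Q, s => Q.eval n D (P.eval n D s)
  | ite a P Q, s => if s.reg a ≠ 0 then P.eval n D s else Q.eval n D s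
  | loop i P, s =>
    (Nat.rec (motive := fun _ => Store) s (fun j t => P.eval n D (t.setReg i j)) n).setReg i n

/-- The registers that a program may change. -/
def regs : Cmd → List ℕ
  | const d _ => [d]
  | size d => [d]
  | add d _ _ => [d]
  | sub d _ _ => [d]
  | load d _ _ => [d]
  | store _ _ _ => []
  | get d _ => [d]
  | put _ _ => []
  | seq P Q => P.regs ++ Q.regs
  | ite _ P Q => P.regs ++ Q.regs
  | loop i P => i :: P.regs

/-- The arrays that a program may change. -/
def arrs : Cmd → List ℕ
  | store A _ _ => [A]
  | put _ _ => [3]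
  | seq P Q => P.arrs ++ Q.arrs
  | ite _ P Q => P.arrs ++ Q.arrs
  | loop _ P => P.arrs
  | _ => []

/-- No loop body changes the loop variable. -/
def wf : Cmd → Bool
  | seq P Q => P.wf && Q.wf
  | ite _ P Q => P.wf && Q.wf
  | loop i P => i ∉ P.regs && P.wf
  | _ => true

theorem eval_loop_induction {n D i : ℕ} {P : Cmd} {s : Store} (I : ℕ → Store → Prop)
    (h0 : I 0 s) (hI : ∀ j < n, ∀ t, I j t → I (j + 1) (P.eval n D (t.setReg i j))) :
    ∃ t, I n t ∧ (loop i P).eval n D s = t.setReg i n := by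
  refine ⟨_, ?_, rfl⟩
  suffices ∀ m ≤ n,
      I m (Nat.rec (motive := fun _ => Store) s (fun j t => P.eval n D (t.setReg i j)) m) from
    this n le_rfl
  intro m hm
  induction m with
  | zero => exact h0
  | succ j ih => exact hI j hm _ (ih (Nat.le_of_succ_le hm))

theorem reg_eval {n D k : ℕ} {P : Cmd} (hk : k ∉ P.regs) (s : Store) :
    (P.eval n D s).reg k = s.reg k := by
  induction P generalizing s with
  | put i b =>
    simp only [eval]
    split_ifs <;> simp
  | seq P Q ihP ihQ =>
    simp only [regs, List.mem_append, not_or] at hk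
    rw [eval, ihQ hk.2, ihP hk.1]
  | ite a P Q ihP ihQ =>
    simp only [regs, List.mem_append, not_or] at hk
    rw [eval]
    split_ifs
    exacts [ihP hk.1 s, ihQ hk.2 s]
  | loop i P ih =>
    simp only [regs, List.mem_cons, not_or] at hk
    obtain ⟨t, ht, h⟩ := eval_loop_induction (n := n) (D := D) (i := i) (P := P) (s := s)
      (fun _ t => t.reg k = s.reg k) rfl fun j _ t ht => by
        rw [ih hk.2, Store.reg_setReg, if_neg hk.1, ht]
    rw [h, Store.reg_setReg, if_neg hk.1, ht]
  | store => rfl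
  | _ =>
    simp only [regs, List.mem_singleton] at hk
    simp [eval, hk]

theorem arr_eval {n D A : ℕ} {P : Cmd} (hA : A ∉ P.arrs) (s : Store) :
    (P.eval n D s).arr A = s.arr A := by
  induction P generalizing s with
  | put i b =>
    simp only [arrs, List.mem_singleton] at hA
    simp only [eval]
    split_ifs
    · funext j
      simp [hA]
    · rfl
  | store B i b =>
    simp only [arrs, List.mem_singleton] at hA
    funext j
    simp [eval, hA]
  | seq P Q ihP ihQ =>
    simp only [arrs, List.mem_append, not_or] at hA
    rw [eval, ihQ hA.2, ihP hA.1]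
  | ite a P Q ihP ihQ =>
    simp only [arrs, List.mem_append, not_or] at hA
    rw [eval]
    split_ifs
    exacts [ihP hA.1 s, ihQ hA.2 s]
  | loop i P ih =>
    obtain ⟨t, ht, h⟩ := eval_loop_induction (n := n) (D := D) (i := i) (P := P) (s := s)
      (fun _ t => t.arr A = s.arr A) rfl fun j _ t ht => by
        rw [ih hA, Store.arr_setReg, ht]
    rw [h, Store.arr_setReg, ht]
  | _ => rfl

/-- The RAM program that leaves the address of the entry of array `A` at the index in register `i`
in register `2`. -/
def addr (A i : ℕ) : Program :=
  .seq (.add 2 0 (i + 4)) (.seq (.add 2 2 (i + 4)) (.seq (.add 2 2 (i + 4))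
    (.seq (.const 3 A) (.add 2 2 3))))

/-- The translation of loop programs to RAM programs.  Register `0` holds the length of the input,
register `1` the loop bound, the registers `2` and `3` hold intermediate results. -/
def compile : Cmd → Program
  | const d c => .const (d + 4) c
  | size d => .copy (d + 4) 1
  | add d a b => .add (d + 4) (a + 4) (b + 4)
  | sub d a b => .sub (d + 4) (a + 4) (b + 4)
  | load d A i => .seq (addr A i) (.load (d + 4) 2)
  | store A i b => .seq (addr A i) (.store 2 (b + 4))
  | get d i => .seq (.sub 2 0 (i + 4)) (.ifNonzero 2 (.load (d + 4) (i + 4)) (.const (d + 4) 0))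
  | put i b => .seq (.sub 2 0 (i + 4)) (.ifNonzero 2 (.store (i + 4) (b + 4)) .skip)
  | seq P Q => .seq P.compile Q.compile
  | ite a P Q => .ifNonzero (a + 4) P.compile Q.compile
  | loop i P => .seq (.const (i + 4) 0) (.seq (.sub 2 1 (i + 4))
      (.whileNonzero 2 (.seq P.compile (.seq (.const 3 1)
        (.seq (.add (i + 4) (i + 4) 3) (.sub 2 1 (i + 4)))))))

/-- A bound on the running time, in terms of the loop bound. -/
noncomputable def cost : Cmd → Polynomial ℕ
  | seq P Q => P.cost + Q.cost
  | ite _ P Q => P.cost + Q.cost + 1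
  -- A round adds one test and three instructions to the body; two initial instructions and the
  -- final test make up the `3`.
  | loop _ P => Polynomial.X * (P.cost + 4) + 3
  -- The maximum is attained by array access: five steps for the address, one for the access.
  | _ => 6

/-- The RAM configuration `σ` represents the configuration `s` of loop programs. -/
structure Represents (n D : ℕ) (s : Store) (σ : State) : Prop where
  reg_zero : σ.reg 0 = D
  reg_one : σ.reg 1 = n
  reg_add : ∀ k, σ.reg (k + 4) = s.reg k
  -- The three arrays are interleaved behind the input cells, so all of them are unbounded and none
  -- overlaps the input.
  mem_arr : ∀ (A : Fin 3) i, σ.mem (D + 3 * i + A) = s.arr A i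
  mem_low : ∀ i < D, σ.mem i = s.arr 3 i

namespace Represents

variable {n D : ℕ} {s : Store} {σ : State}

theorem setReg (h : Represents n D s σ) (d x : ℕ) :
    Represents n D (s.setReg d x) (σ.setReg (d + 4) x) where
  reg_zero := by simpa [State.setReg, Function.update_apply] using h.reg_zero
  reg_one := by simpa [State.setReg, Function.update_apply] using h.reg_one
  reg_add k := by simp [State.setReg, Function.update_apply, h.reg_add k]
  mem_arr := h.mem_arr
  mem_low := h.mem_low

theorem setReg_aux (h : Represents n D s σ) {d : ℕ} (x : ℕ) (hd : d = 2 ∨ d = 3) :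
    Represents n D s (σ.setReg d x) where
  reg_zero := by
    rcases hd with rfl | rfl <;> simpa [State.setReg, Function.update_apply] using h.reg_zero
  reg_one := by
    rcases hd with rfl | rfl <;> simpa [State.setReg, Function.update_apply] using h.reg_one
  reg_add k := by
    rcases hd with rfl | rfl <;> simp [State.setReg, h.reg_add k]
  mem_arr := h.mem_arr
  mem_low := h.mem_low

theorem setArr (h : Represents n D s σ) (A : Fin 3) (i x : ℕ) :
    Represents n D (s.setArr A i x) (σ.setMem (D + 3 * i + A) x) where
  reg_zero := h.reg_zero
  reg_one := h.reg_one
  reg_add := h.reg_add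
  mem_arr B j := by
    have hiff : D + 3 * j + B = D + 3 * i + A ↔ ((B : ℕ) = A ∧ j = i) := by omega
    simp only [State.setMem, Function.update_apply, hiff, Store.arr_setArr, h.mem_arr B j]
  mem_low j hj := by
    have h1 : j ≠ D + 3 * i + A := by omega
    have h2 : (3 : ℕ) ≠ A := by omega
    simp [State.setMem, h1, h2, h.mem_low j hj]

theorem setLow (h : Represents n D s σ) {i : ℕ} (hi : i < D) (x : ℕ) :
    Represents n D (s.setArr 3 i x) (σ.setMem i x) where
  reg_zero := h.reg_zero
  reg_one := h.reg_one
  reg_add := h.reg_add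
  mem_arr B j := by
    have h1 : D + 3 * j + B ≠ i := by omega
    have h2 : (B : ℕ) ≠ 3 := by omega
    simp [State.setMem, h1, h2, h.mem_arr B j]
  mem_low j hj := by
    simp [State.setMem, Function.update_apply, h.mem_low j hj]

theorem exec_addr (h : Represents n D s σ) (A i : ℕ) :
    ∃ σ', Exec (addr A i) σ 5 σ' ∧ Represents n D s σ' ∧ σ'.reg 2 = D + 3 * s.reg i + A := by
  refine ⟨_, .seq (.add ..) (.seq (.add ..) (.seq (.add ..) (.seq (.const ..) (.add ..)))), ?_, ?_⟩
  · exact ((((h.setReg_aux _ (.inl rfl)).setReg_aux _ (.inl rfl)).setReg_aux _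
      (.inl rfl)).setReg_aux _ (.inr rfl)).setReg_aux _ (.inl rfl)
  · simp [State.setReg, h.reg_add, h.reg_zero]
    omega

end Represents

/-- The translation is correct and respects the bound on the running time. -/
theorem exec_compile {n D : ℕ} {P : Cmd} (hP : P.wf) {s : Store} {σ : State}
    (h : Represents n D s σ) :
    ∃ t σ', Exec P.compile σ t σ' ∧ t ≤ P.cost.eval n ∧ Represents n D (P.eval n D s) σ' := by
  induction P generalizing s σ with
  | const d c => exact ⟨_, _, .const .., by simp [cost], h.setReg d c⟩
  | size d =>
    exact ⟨_, _, .copy .., by simp [cost], by simpa [eval, h.reg_one] using h.setReg d (σ.reg 1)⟩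
  | add d a b =>
    exact ⟨_, _, .add .., by simp [cost], by simpa [eval, h.reg_add] using h.setReg d _⟩
  | sub d a b =>
    exact ⟨_, _, .sub .., by simp [cost], by simpa [eval, h.reg_add] using h.setReg d _⟩
  | load d A i =>
    obtain ⟨σ', hex, h', h2⟩ := h.exec_addr A i
    refine ⟨_, _, .seq hex (.load ..), by simp [cost], ?_⟩
    rw [h2, h'.mem_arr]
    exact h'.setReg d _
  | store A i b =>
    obtain ⟨σ', hex, h', h2⟩ := h.exec_addr A i
    refine ⟨_, _, .seq hex (.store ..), by simp [cost], ?_⟩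
    rw [h2, h'.reg_add]
    exact h'.setArr A _ _
  | get d i =>
    have h' := h.setReg_aux (σ.reg 0 - σ.reg (i + 4)) (.inl rfl)
    simp only [eval]
    by_cases hi : s.reg i < D
    · refine ⟨_, _, .seq (.sub ..) (.if_true ?_ (.load ..)), by simp [cost], ?_⟩
      · simp [State.setReg, h.reg_zero, h.reg_add]
        omega
      · rw [h'.reg_add, h'.mem_low _ hi, if_pos hi]
        exact h'.setReg d _
    · refine ⟨_, _, .seq (.sub ..) (.if_false ?_ (.const ..)), by simp [cost], ?_⟩
      · simp [State.setReg, h.reg_zero, h.reg_add]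
        omega
      · rw [if_neg hi]
        exact h'.setReg d _
  | put i b =>
    have h' := h.setReg_aux (σ.reg 0 - σ.reg (i + 4)) (.inl rfl)
    simp only [eval]
    by_cases hi : s.reg i < D
    · refine ⟨_, _, .seq (.sub ..) (.if_true ?_ (.store ..)), by simp [cost], ?_⟩
      · simp [State.setReg, h.reg_zero, h.reg_add]
        omega
      · rw [h'.reg_add, h'.reg_add, if_pos hi]
        exact h'.setLow hi _
    · refine ⟨_, _, .seq (.sub ..) (.if_false ?_ (.skip ..)), by simp [cost], ?_⟩
      · simp [State.setReg, h.reg_zero, h.reg_add]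
        omega
      · rw [if_neg hi]
        exact h'
  | seq P Q ihP ihQ =>
    simp only [wf, Bool.and_eq_true] at hP
    obtain ⟨t, σ₁, hex, ht, h₁⟩ := ihP hP.1 h
    obtain ⟨u, σ₂, hex', hu, h₂⟩ := ihQ hP.2 h₁
    exact ⟨_, _, .seq hex hex', by simpa [cost] using add_le_add ht hu, h₂⟩
  | ite a P Q ihP ihQ =>
    simp only [wf, Bool.and_eq_true] at hP
    simp only [eval]
    by_cases ha : s.reg a ≠ 0
    · obtain ⟨t, σ₁, hex, ht, h₁⟩ := ihP hP.1 h
      refine ⟨_, _, .if_true (by rwa [h.reg_add]) hex, ?_, by rwa [if_pos ha]⟩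
      simp [cost]
      omega
    · obtain ⟨t, σ₁, hex, ht, h₁⟩ := ihQ hP.2 h
      refine ⟨_, _, .if_false (by rw [h.reg_add]; exact not_not.1 ha) hex, ?_, by rwa [if_neg ha]⟩
      simp [cost]
      omega
  | loop i P ih =>
    simp only [wf, Bool.and_eq_true, decide_eq_true_eq] at hP
    -- `j` rounds are done and `m` remain; register `2` holds the difference `n - j` that the
    -- `while` tests.
    have key : ∀ m j : ℕ, j + m = n → ∀ (s : Store) (σ : State),
        Represents n D (s.setReg i j) σ → σ.reg 2 = n - j →
        ∃ t σ', Exec (.whileNonzero 2 (.seq P.compile (.seq (.const 3 1)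
          (.seq (.add (i + 4) (i + 4) 3) (.sub 2 1 (i + 4)))))) σ t σ' ∧
          t ≤ m * (P.cost.eval n + 4) + 1 ∧
          Represents n D ((Nat.rec (motive := fun _ => Store) s
            (fun k t => P.eval n D (t.setReg i (j + k))) m).setReg i n) σ' := by
      intro m
      induction m with
      | zero =>
        intro j hj s σ h h2
        refine ⟨1, σ, .while_false (by omega), by simp, ?_⟩
        simpa [show n = j by omega] using h
      | succ m ihm =>
        intro j hj s σ h h2
        obtain ⟨t, σ₁, hex, ht, h₁⟩ := ih hP.2 h
        have hji : σ₁.reg (i + 4) = j := by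
          rw [h₁.reg_add, reg_eval hP.1]
          simp
        obtain ⟨u, σ₂, hex', hu, h₂⟩ := ihm (j + 1) (by omega) (P.eval n D (s.setReg i j))
          (((σ₁.setReg 3 1).setReg (i + 4) (j + 1)).setReg 2 (n - (j + 1)))
          (((h₁.setReg_aux 1 (.inr rfl)).setReg i (j + 1)).setReg_aux _ (.inl rfl))
          (by simp [State.setReg])
        refine ⟨_, σ₂, .while_true (by omega) (.seq hex (.seq (.const ..) (.seq (.add ..)
          (.sub ..)))) (u := u) ?_, ?_, ?_⟩
        · convert hex' using 1
          simp [State.setReg, hji, h₁.reg_one]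
        · rw [add_mul]
          omega
        · convert h₂ using 2
          clear * -
          -- The recursor splits off the last round, the `while` loop the first; shifting the
          -- counter reconciles the two.
          have hshift : ∀ m, (Nat.rec (motive := fun _ => Store) s
              (fun k t => P.eval n D (t.setReg i (j + k))) (m + 1) : Store) =
              Nat.rec (motive := fun _ => Store) (P.eval n D (s.setReg i j))
                (fun k t => P.eval n D (t.setReg i (j + 1 + k))) m := by
            intro m
            induction m with
            | zero => rfl
            | succ m ih =>
              simp only at ih ⊢
              rw [← ih]
              simp only [show j + 1 + m = j + (m + 1) by omega]
          exact hshift m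
    have h₀ := (h.setReg i 0).setReg_aux (d := 2) n (.inl rfl)
    obtain ⟨t, σ', hex, ht, h'⟩ := key n 0 (by omega) s _ h₀ (by simp [State.setReg])
    refine ⟨_, σ', .seq (.const ..) (.seq (.sub ..) (u := t) ?_), ?_, ?_⟩
    · convert hex using 1
      simp [State.setReg, h.reg_one]
    · simp [cost]
      omega
    · simpa [eval] using h'

/-- The RAM program that runs the loop program `P`, with the first number of the input as loop
bound, and shows that many entries of array `3`. -/
def toProgram (P : Cmd) : Program := .seq (.load 1 1) (.seq P.compile (.copy 0 1))

theorem outputsInTime_toProgram {P : Cmd} (hP : P.wf) {x y : List ℕ}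
    (hn : x.getD 0 0 = y.length) (hle : y.length ≤ x.length)
    (hy : ∀ (i : ℕ) (h : i < y.length),
      (P.eval y.length x.length (Store.init x)).arr 3 i = y[i]) :
    OutputsInTime P.toProgram x y ((P.cost + 2).eval y.length) := by
  -- Register `1` is `0` at the start, so the first `load` fetches cell `0`, which holds the loop
  -- bound.
  have h₀ : Represents y.length x.length (Store.init x)
      ((State.init x).setReg 1 ((State.init x).mem ((State.init x).reg 1))) := by
    constructor
    · simp [State.init, State.setReg]
    · simp only [State.init, State.setReg, Function.update_apply]
      simpa using hn
    · intro k
      simp [State.init, State.setReg, Store.init]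
    · intro A i
      have h3 : (A : ℕ) ≠ 3 := by omega
      simp only [State.init, State.setReg, Store.init, if_neg h3]
      exact List.getD_eq_default _ _ (by omega)
    · intro i _
      simp [State.init, State.setReg, Store.init]
  obtain ⟨t, σ', hex, ht, h'⟩ := exec_compile hP h₀
  refine ⟨_, _, .seq (.load ..) (.seq hex (.copy ..)), ?_, ?_, ?_⟩
  · simp
    omega
  · simp [State.setReg, h'.reg_one]
  · intro i hi
    rw [← hy i hi]
    exact h'.mem_low i (hi.trans_le hle)

end Cmd

end RAM

/-! ### Loop invariants -/

namespace RAM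

namespace Cmd

/-- `t` differs from `s` only in registers and arrays that the program `P` may change. -/
def Frame (P : Cmd) (s t : Store) : Prop :=
  (∀ k ∉ P.regs, t.reg k = s.reg k) ∧ ∀ A ∉ P.arrs, t.arr A = s.arr A

/-- The induction principle for loops. -/
theorem eval_loop_induction_frame {n D i : ℕ} {P : Cmd} {s : Store} (I : ℕ → Store → Prop)
    (hset : ∀ j t x, I j t → I j (t.setReg i x)) (h0 : I 0 s)
    (hI : ∀ j < n, ∀ t, Frame (loop i P) s t → t.reg i = j → I j t → I (j + 1) (P.eval n D t)) :
    I n ((loop i P).eval n D s) := by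
  obtain ⟨t, ⟨ht, -⟩, h⟩ := eval_loop_induction (n := n) (D := D) (i := i) (P := P) (s := s)
    (fun j t => I j t ∧ Frame (loop i P) s t) ⟨h0, fun _ _ => rfl, fun _ _ => rfl⟩
    fun j hj t ⟨ht, hf⟩ => by
      have hf' : Frame (loop i P) s (t.setReg i j) := by
        refine ⟨fun k hk => ?_, hf.2⟩
        have hki : k ≠ i := fun h => hk (by simp [regs, h])
        simpa [hki] using hf.1 k hk
      refine ⟨hI j hj _ hf' (by simp) (hset j t j ht), fun k hk => ?_, fun A hA => ?_⟩
      · rw [reg_eval (fun h => hk (by simp [regs, h])), hf'.1 k hk]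
      · rw [arr_eval (P := P) hA, hf'.2 A hA]
  rw [h]
  exact hset _ _ _ ht

end Cmd

end RAM

/-! ### The program for vector connectivity

Array `0` holds the best solution so far, array `1` the solution that is being improved, and
array `2` the marks of a graph search. -/

namespace VecCon

open RAM RAM.Cmd

/-- The set of vertices at which `f` does not vanish. -/
def supp (n : ℕ) (f : ℕ → ℕ) : Finset (Fin n) := Finset.univ.filter fun v => f v ≠ 0

@[simp] theorem mem_supp {n : ℕ} {f : ℕ → ℕ} {v : Fin n} : v ∈ supp n f ↔ f v ≠ 0 := by
  simp [supp]

/-- The cells `f`, of which the first `D` hold the input, describe `(G, r)`. -/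
structure Encodes {n : ℕ} (G : SimpleGraph (Fin n)) (r : Fin n → ℕ) (D : ℕ) (f : ℕ → ℕ) :
    Prop where
  length_eq : D = 1 + n * n + n
  adj : ∀ u v : Fin n, f (1 + n * u + v) ≠ 0 ↔ G.Adj u v
  req : ∀ v : Fin n, f (1 + n * n + v) = r v

def skip : Cmd := .const 10 0

/-- Register `6` becomes `1 + n * a + b`. -/
def address (a b : ℕ) : Cmd := .seq (.const 6 1) (.seq (.loop 5 (.add 6 6 a)) (.add 6 6 b))

/-- Register `9` becomes nonzero if and only if `a ≠ b`. -/
def neq (a b : ℕ) : Cmd := .seq (.sub 9 a b) (.seq (.sub 10 b a) (.add 9 9 10))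

def copyArr (A B : Fin 3) : Cmd := .loop 1 (.seq (.load 7 A 1) (.store B 1 7))

/-- Register `d` becomes the number of nonzero entries of array `A`. -/
def count (d : ℕ) (A : Fin 3) : Cmd :=
  .seq (.const d 0) (.loop 1 (.seq (.load 7 A 1)
    (.ite 7 (.seq (.const 14 1) (.add d d 14)) skip)))

/-- Passes a mark along the edge from the vertex in register `2` to the vertex in register `3`,
unless the latter is the vertex in register `0`. -/
def edgeStep : Cmd :=
  .seq (.load 7 2 2) (.ite 7 (.seq (address 2 3) (.seq (.get 8 6) (.ite 8
    (.seq (neq 3 0) (.ite 9 (.seq (.const 14 1) (.store 2 3 14)) skip)) skip))) skip)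

def edgeRound : Cmd := .loop 2 (.loop 3 edgeStep)

/-- Marks the vertices connected to array `1` in the graph without the vertex in register `0`. -/
def search : Cmd :=
  .seq (copyArr 1 2) (.seq (.const 13 0) (.seq (.store 2 0 13) (.loop 4 edgeRound)))

/-- Sets register `12` to `0` if the vertex in register `1` is unmarked and has a demand for the
vertex in register `0`. -/
def testVertex : Cmd :=
  .seq (.load 7 2 1) (.ite 7 skip (.seq (neq 1 0) (.ite 9 (.seq (.size 16)
    (.seq (address 16 1) (.seq (.get 8 6) (.seq (.sub 8 8 11) (.ite 8 (.const 12 0) skip))))) skip)))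

def testAt : Cmd :=
  .seq search (.seq (.size 16) (.seq (.sub 11 16 0) (.seq (.ite 11 (.const 11 1) skip)
    (.loop 1 testVertex))))

/-- Register `12` becomes nonzero if and only if array `1` meets all demands. -/
def test : Cmd := .seq (.const 12 1) (.seq (.loop 0 testAt) testAt)

/-- Removes the vertex in register `17` from array `1` if it is redundant and different from the
one in register `15`. -/
def pruneAt : Cmd :=
  .seq (neq 17 15) (.ite 9 (.seq (.load 18 1 17) (.seq (.const 13 0) (.seq (.store 1 17 13)
    (.seq test (.ite 12 skip (.store 1 17 18)))))) skip)

/-- Tries to improve the solution by one that contains the vertex in register `15`. -/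
def improveAt : Cmd :=
  .seq (copyArr 0 1) (.seq (.const 14 1) (.seq (.store 1 15 14) (.seq (.loop 17 pruneAt)
    (.seq (count 19 0) (.seq (count 20 1) (.seq (.sub 21 19 20)
      (.ite 21 (copyArr 1 0) skip)))))))

def output : Cmd :=
  .loop 1 (.seq (.load 7 0 1) (.seq (.ite 7 (.const 7 1) skip) (.put 1 7)))

def solve : Cmd :=
  .seq (.const 14 1) (.seq (.loop 1 (.store 0 1 14)) (.seq (.size 15)
    (.seq improveAt (.seq (.loop 15 improveAt) output))))

theorem wf_solve : solve.wf := by decide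

/-! ### Correctness of the program -/

variable {n D : ℕ} {s : Store}

/-- The product arises by adding `a` in each of the `n` rounds; the operands must not be the
registers `5` and `6`, which are overwritten. -/
theorem eval_address {a b : ℕ} (ha : a ≠ 5 ∧ a ≠ 6) (hb : b ≠ 5 ∧ b ≠ 6) :
    (address a b).eval n D s =
      (s.setReg 5 n).setReg 6 (1 + n * s.reg a + s.reg b) := by
  obtain ⟨t, ht, h⟩ := eval_loop_induction (n := n) (D := D) (i := 5) (P := .add 6 6 a)
    (s := s.setReg 6 1) (fun j t => t.arr = s.arr ∧ t.reg 6 = 1 + j * s.reg a ∧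
      ∀ k, k ≠ 5 → k ≠ 6 → t.reg k = s.reg k) (by simp +contextual) fun j _ t ⟨h1, h2, h3⟩ => by
      refine ⟨h1, ?_, fun k hk hk' => ?_⟩
      · simp [eval, ha.1, h2, h3 a ha.1 ha.2]
        ring
      · simp [eval, hk, hk', h3]
  simp only [address, eval] at h ⊢
  rw [h]
  ext k
  · by_cases h5 : k = 5
    · simp [h5]
    by_cases h6 : k = 6
    · simp [h6, ht.2.1, hb.1, ht.2.2 b hb.1 hb.2]
    · simp [h5, h6, ht.2.2 k h5 h6]
  · simp [ht.1]

theorem arr_copyArr (A B : Fin 3) (hAB : A ≠ B) :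
    ∀ j < n, ((copyArr A B).eval n D s).arr B j = s.arr A j := by
  refine eval_loop_induction_frame (fun j t => ∀ i < j, t.arr B i = s.arr A i)
    (fun _ _ _ h => h) (by simp) ?_
  · intro j hj t hf h1 h i hi
    have hA := hf.2 A (by simpa [arrs, Fin.ext_iff] using hAB)
    simp only [eval, Store.arr_setArr, Store.reg_setReg, Store.arr_setReg]
    by_cases hij : i = j
    · simp [h1, hA, hij]
    · simpa [h1, hA, hij] using h i (by omega)

theorem reg_count {d : ℕ} (A : Fin 3) (hd : d ≠ 1 ∧ d ≠ 7 ∧ d ≠ 10 ∧ d ≠ 14) :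
    ((count d A).eval n D s).reg d = (supp n (s.arr A)).card := by
  have key := eval_loop_induction_frame (n := n) (D := D) (i := 1)
    (P := .seq (.load 7 A 1) (.ite 7 (.seq (.const 14 1) (.add d d 14)) skip))
    (s := s.setReg d 0)
    (fun j t => t.reg d = ((Finset.range j).filter fun i => s.arr A i ≠ 0).card)
    (fun j t x h => by simpa [hd.1] using h) (by simp)
    fun j hj t hf h1 h => by
      have hA : t.arr A = s.arr A := hf.2 A (by simp [arrs, skip])
      rw [Finset.range_add_one, Finset.filter_insert]
      by_cases h0 : s.arr A j = 0
      · simp [eval, skip, h1, hA, h0, hd.2.1, hd.2.2.1, h]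
      · simp [eval, h1, hA, h0, hd.2.1, hd.2.2.2, h]
  simp only [count, eval] at key ⊢
  rw [key, ← Finset.card_map Fin.valEmbedding]
  congr 1
  ext i
  simp only [Finset.mem_filter, Finset.mem_range, Finset.mem_map, mem_supp, Fin.valEmbedding_apply]
  constructor
  · rintro ⟨h, h'⟩
    exact ⟨⟨i, h⟩, h', rfl⟩
  · rintro ⟨v, h, rfl⟩
    exact ⟨v.2, h⟩

variable {G : SimpleGraph (Fin n)} {r : Fin n → ℕ}

theorem arr_edgeStep (henc : Encodes G r D (s.arr 3)) {u w : Fin n} (hu : s.reg 2 = u)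
    (hw : s.reg 3 = w) (j : ℕ) :
    (edgeStep.eval n D s).arr 2 j ≠ 0 ↔
      s.arr 2 j ≠ 0 ∨ (j = w ∧ s.arr 2 u ≠ 0 ∧ G.Adj u w ∧ (w : ℕ) ≠ s.reg 0) := by
  have hlt : 1 + n * u + w < D := by
    have := Nat.mul_le_mul_left n u.2.le
    have := w.2
    rw [henc.length_eq]
    omega
  have hadj := henc.adj u w
  by_cases h1 : s.arr 2 u = 0
  · simp [edgeStep, eval, skip, hu, h1]
  by_cases h2 : s.arr 3 (1 + n * u + w) = 0
  · have : ¬ G.Adj u w := fun h => hadj.2 h h2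
    simp [edgeStep, eval, skip, hu, hw, h1, eval_address, hlt, h2, this]
  · by_cases h3 : (w : ℕ) = s.reg 0
    · have h4 : (w : ℕ) - s.reg 0 = 0 ∧ s.reg 0 - w = 0 := by omega
      simp [edgeStep, eval, skip, neq, hu, hw, h1, eval_address, hlt, h2, eq_true h3, h4.1, h4.2]
    · have h4 : ¬ ((w : ℕ) - s.reg 0 = 0 ∧ s.reg 0 - w = 0) := by omega
      simp only [edgeStep, eval, skip, neq]
      simp [hu, hw, h1, eval_address, hlt, h2, h3, h4, hadj.1 h2]
      by_cases hjw : j = w <;> simp [hjw]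

/-- A new mark may travel on within the same round, so the result is only bracketed: from below by
old marks and their neighbours, from above by every set closed under passing marks. -/
theorem arr_edgeRound (henc : Encodes G r D (s.arr 3)) :
    (∀ v, s.arr 2 v ≠ 0 → (edgeRound.eval n D s).arr 2 v ≠ 0) ∧
    (∀ u w : Fin n, s.arr 2 u ≠ 0 → G.Adj u w → (w : ℕ) ≠ s.reg 0 →
      (edgeRound.eval n D s).arr 2 w ≠ 0) ∧
    ∀ B : Set (Fin n), (∀ v : Fin n, s.arr 2 v ≠ 0 → v ∈ B) →
      (∀ u w : Fin n, u ∈ B → G.Adj u w → (w : ℕ) ≠ s.reg 0 → w ∈ B) →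
      ∀ v : Fin n, (edgeRound.eval n D s).arr 2 v ≠ 0 → v ∈ B := by
  have key := eval_loop_induction_frame (n := n) (D := D) (i := 2) (P := .loop 3 edgeStep)
    (s := s) (fun k t => (∀ v, s.arr 2 v ≠ 0 → t.arr 2 v ≠ 0) ∧
      (∀ u w : Fin n, (u : ℕ) < k → s.arr 2 u ≠ 0 → G.Adj u w → (w : ℕ) ≠ s.reg 0 →
        t.arr 2 w ≠ 0) ∧
      ∀ B : Set (Fin n), (∀ v : Fin n, s.arr 2 v ≠ 0 → v ∈ B) →
        (∀ u w : Fin n, u ∈ B → G.Adj u w → (w : ℕ) ≠ s.reg 0 → w ∈ B) →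
        ∀ v : Fin n, t.arr 2 v ≠ 0 → v ∈ B)
    (fun _ _ _ h => h)
    ⟨fun _ h => h, fun _ _ h => absurd h (Nat.not_lt_zero _), fun _ h _ => h⟩
    fun k hk t hf htk ⟨h1, h2, h3⟩ => by
      have h0 : t.reg 0 = s.reg 0 := hf.1 0 (by decide)
      have henc' : t.arr 3 = s.arr 3 := hf.2 3 (by decide)
      have inner := eval_loop_induction_frame (n := n) (D := D) (i := 3) (P := edgeStep)
        (s := t) (fun l t' => (∀ v, t.arr 2 v ≠ 0 → t'.arr 2 v ≠ 0) ∧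
          (∀ w : Fin n, (w : ℕ) < l → t.arr 2 k ≠ 0 → G.Adj ⟨k, hk⟩ w → (w : ℕ) ≠ s.reg 0 →
            t'.arr 2 w ≠ 0) ∧
          ∀ B : Set (Fin n), (∀ v : Fin n, t.arr 2 v ≠ 0 → v ∈ B) →
            (∀ u w : Fin n, u ∈ B → G.Adj u w → (w : ℕ) ≠ s.reg 0 → w ∈ B) →
            ∀ v : Fin n, t'.arr 2 v ≠ 0 → v ∈ B)
        (fun _ _ _ h => h)
        ⟨fun _ h => h, fun _ h => absurd h (Nat.not_lt_zero _), fun _ h _ => h⟩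
        fun l hl t' hf' htl ⟨g1, g2, g3⟩ => by
          have h0' : t'.reg 0 = s.reg 0 := (hf'.1 0 (by decide)).trans h0
          have h2' : t'.reg 2 = k := (hf'.1 2 (by decide)).trans htk
          have step := arr_edgeStep (s := t') (u := ⟨k, hk⟩) (w := ⟨l, hl⟩)
            (by rw [hf'.2 3 (by decide), henc']; exact henc) h2' htl
          rw [h0'] at step
          refine ⟨fun v hv => (step v).2 (.inl (g1 v hv)), fun w hw hk' hadj hne => ?_,
            fun B hB hB' v hv => ?_⟩
          · rcases Nat.lt_succ_iff_lt_or_eq.1 hw with hlt | heq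
            · exact (step w).2 (.inl (g2 w hlt hk' hadj hne))
            · obtain rfl : w = ⟨l, hl⟩ := Fin.ext heq
              exact (step _).2 (.inr ⟨rfl, g1 _ hk', hadj, hne⟩)
          · rcases (step v).1 hv with hv | ⟨hvl, hk', hadj, hne⟩
            · exact g3 B hB hB' v hv
            · obtain rfl : v = ⟨l, hl⟩ := Fin.ext hvl
              exact hB' _ _ (g3 B hB hB' ⟨k, hk⟩ hk') hadj hne
      obtain ⟨g1, g2, g3⟩ := inner
      refine ⟨fun v hv => g1 v (h1 v hv), fun u w hu hu' hadj hne => ?_, fun B hB hB' =>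
        g3 B (h3 B hB hB') hB'⟩
      rcases Nat.lt_succ_iff_lt_or_eq.1 hu with hlt | heq
      · exact g1 _ (h2 u w hlt hu' hadj hne)
      · obtain rfl : u = ⟨k, hk⟩ := Fin.ext heq
        exact g2 w w.2 (h1 _ hu') hadj hne
  exact ⟨key.1, fun u w => key.2.1 u w u.2, key.2.2⟩

/-- Reachability is symmetric, so a single search from the whole solution serves all `v`. If
register `0` holds `n`, the erased mark belongs to no vertex and nothing is avoided. -/
theorem arr_search (henc : Encodes G r D (s.arr 3)) (v : Fin n) :
    (search.eval n D s).arr 2 v ≠ 0 ↔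
      ∃ t ∈ supp n (s.arr 1), ReachIn G (avoid n (s.reg 0)) v t := by
  classical
  set s₁ : Store := ((((copyArr 1 2).eval n D s).setReg 13 0).setArr 2 (s.reg 0) 0) with hs₁
  have hinit : ∀ w : Fin n, s₁.arr 2 w ≠ 0 ↔ s.arr 1 w ≠ 0 ∧ (w : ℕ) ≠ s.reg 0 := by
    intro w
    have := arr_copyArr (n := n) (D := D) (s := s) 1 2 (by decide) w w.2
    simp only [Fin.val_one, Fin.val_two] at this
    simp [hs₁, this]
    tauto
  have hs₁0 : s₁.reg 0 = s.reg 0 := by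
    have := reg_eval (n := n) (D := D) (k := 0) (P := copyArr 1 2) (by decide) s
    simpa [hs₁] using this
  have hs₁3 : s₁.arr 3 = s.arr 3 := by
    funext j
    have := congrFun (arr_eval (n := n) (D := D) (A := 3) (P := copyArr 1 2) (by decide) s) j
    simpa [hs₁] using this
  have heval : search.eval n D s = (Cmd.loop 4 edgeRound).eval n D s₁ := by
    have h0 := reg_eval (n := n) (D := D) (k := 0) (P := copyArr 1 2) (by decide) s
    simp only [search, eval, hs₁, Store.reg_setReg]
    simp [h0]
  -- After `k` rounds all vertices with an admissible walk of length at most `k` to the solution are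
  -- marked, and marked vertices have some admissible walk.
  have key := eval_loop_induction_frame (n := n) (D := D) (i := 4) (P := edgeRound)
    (s := s₁) (fun k t =>
      (∀ v : Fin n, (∃ w ∈ supp n (s.arr 1), ∃ p : G.Walk v w, p.length ≤ k ∧
        ∀ x ∈ p.support, x ∈ avoid n (s.reg 0)) → t.arr 2 v ≠ 0) ∧
      ∀ v : Fin n, t.arr 2 v ≠ 0 → ∃ w ∈ supp n (s.arr 1), ReachIn G (avoid n (s.reg 0)) v w)
    (fun _ _ _ h => h)
    ⟨by
      rintro v ⟨w, hw, p, hp, hav⟩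
      cases p with
      | nil => exact (hinit v).2 ⟨mem_supp.1 hw, hav v (by simp)⟩
      | cons h p => simp at hp,
     fun v hv => ⟨v, mem_supp.2 ((hinit v).1 hv).1, .refl ((hinit v).1 hv).2⟩⟩
    fun k hk t hf htk ⟨h1, h2⟩ => by
      have h0 : t.reg 0 = s.reg 0 := (hf.1 0 (by decide)).trans hs₁0
      have henc' : t.arr 3 = s.arr 3 := (hf.2 3 (by decide)).trans hs₁3
      obtain ⟨g1, g2, g3⟩ := arr_edgeRound (s := t) (G := G) (r := r) (D := D)
        (by rw [henc']; exact henc)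
      rw [h0] at g2 g3
      refine ⟨?_, g3 {v | ∃ w ∈ supp n (s.arr 1), ReachIn G (avoid n (s.reg 0)) v w} h2 ?_⟩
      · rintro v ⟨w, hw, p, hp, hav⟩
        cases p with
        | nil => exact g1 _ (h1 v ⟨v, hw, .nil, by simp, hav⟩)
        | cons h p =>
          exact g2 _ v (h1 _ ⟨w, hw, p, by simpa using hp, fun x hx => hav x (by simp [hx])⟩)
            h.symm (hav v (by simp))
      · rintro u w ⟨a, ha, hua⟩ hadj hne
        exact ⟨a, ha, .head hne hadj.symm hua⟩
  rw [heval]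
  refine ⟨key.2 v, ?_⟩
  rintro ⟨w, hw, h⟩
  obtain ⟨p, hp⟩ := h.exists_walk
  refine key.1 v ⟨w, hw, p.toPath, ?_, fun x hx =>
    hp x (SimpleGraph.Walk.support_toPath_subset_support _ hx)⟩
  -- A path has fewer than `n` edges, so `n` rounds suffice.
  have := p.toPath.2.length_lt
  rw [Fintype.card_fin] at this
  exact this.le

/-- Truncated subtraction of register `11` from `r v` is nonzero exactly when `r v` reaches the
threshold `2` or `1` of `Demand`. -/
theorem reg_testVertex (henc : Encodes G r D (s.arr 3)) {v : Fin n} (hv : s.reg 1 = v)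
    (hth : s.reg 11 = if s.reg 0 < n then 1 else 0) :
    (testVertex.eval n D s).reg 12 ≠ 0 ↔
      s.reg 12 ≠ 0 ∧ (Demand r v (s.reg 0) → s.arr 2 v ≠ 0) := by
  have hlt : 1 + n * n + v < D := by
    have := v.2
    rw [henc.length_eq]
    omega
  have hreq := henc.req v
  by_cases h1 : s.arr 2 v = 0
  · by_cases h2 : (v : ℕ) = s.reg 0
    · have h3 : (v : ℕ) - s.reg 0 = 0 ∧ s.reg 0 - v = 0 := by omega
      simp [testVertex, eval, neq, skip, hv, h1, eq_true h2, h3.1, h3.2, Demand]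
    · have h3 : ¬ ((v : ℕ) - s.reg 0 = 0 ∧ s.reg 0 - v = 0) := by omega
      by_cases h4 : r v - s.reg 11 = 0
      · have h5 : ¬ Demand r v (s.reg 0) := by
          rintro ⟨-, h⟩
          split_ifs at h hth <;> omega
        simp [testVertex, eval, neq, skip, hv, h1, h3, h5, h4, eval_address, hlt, hreq]
      · have h5 : Demand r v (s.reg 0) := by
          refine ⟨h2, ?_⟩
          split_ifs at hth ⊢ <;> omega
        simp [testVertex, eval, neq, skip, hv, h1, h3, h5, h4, eval_address, hlt, hreq]
  · simp [testVertex, eval, skip, hv, h1]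

theorem reg_testAt (henc : Encodes G r D (s.arr 3)) :
    (testAt.eval n D s).reg 12 ≠ 0 ↔ s.reg 12 ≠ 0 ∧ ∀ v, Demand r v (s.reg 0) →
      ∃ t ∈ supp n (s.arr 1), ReachIn G (avoid n (s.reg 0)) v t := by
  set P : Cmd := .seq search (.seq (.size 16) (.seq (.sub 11 16 0) (.ite 11 (.const 11 1) skip)))
    with hP
  set s₁ : Store := P.eval n D s with hs₁
  have h0 : s₁.reg 0 = s.reg 0 := reg_eval (by decide) s
  have h12 : s₁.reg 12 = s.reg 12 := reg_eval (by decide) s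
  have h3 : s₁.arr 3 = s.arr 3 := arr_eval (by decide) s
  have h2 : s₁.arr 2 = (search.eval n D s).arr 2 :=
    arr_eval (P := .seq (.size 16) (.seq (.sub 11 16 0) (.ite 11 (.const 11 1) skip)))
      (by decide) _
  have h11 : s₁.reg 11 = if s₁.reg 0 < n then 1 else 0 := by
    rw [h0]
    have h0' : (search.eval n D s).reg 0 = s.reg 0 := reg_eval (by decide) s
    by_cases hlt : s.reg 0 < n
    · have : n - s.reg 0 ≠ 0 := by omega
      simp [hs₁, hP, eval, skip, h0', this, hlt]
    · have : n - s.reg 0 = 0 := by omega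
      simp [hs₁, hP, eval, skip, h0', this, hlt]
  have heval : testAt.eval n D s = (Cmd.loop 1 testVertex).eval n D s₁ := rfl
  have key := eval_loop_induction_frame (n := n) (D := D) (i := 1) (P := testVertex) (s := s₁)
    (fun k t => t.reg 12 ≠ 0 ↔ s.reg 12 ≠ 0 ∧
      ∀ v : Fin n, (v : ℕ) < k → Demand r v (s.reg 0) → s₁.arr 2 v ≠ 0)
    (fun _ _ _ h => by simpa using h) (by simp [h12])
    fun k hk t hf htk h => by
      have g0 : t.reg 0 = s₁.reg 0 := hf.1 0 (by decide)
      have g11 : t.reg 11 = s₁.reg 11 := hf.1 11 (by decide)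
      have g2 : t.arr 2 = s₁.arr 2 := hf.2 2 (by decide)
      have g3 : t.arr 3 = s.arr 3 := (hf.2 3 (by decide)).trans h3
      have step := reg_testVertex (s := t) (v := ⟨k, hk⟩) (by rw [g3]; exact henc) htk
        (by rw [g0, g11, h11])
      rw [step, h, g2, g0, h0, and_assoc]
      refine and_congr_right fun _ => ⟨fun h v hv => ?_, fun h => ⟨fun v hv => h v (by omega),
        h ⟨k, hk⟩ (Nat.lt_succ_self k)⟩⟩
      rcases Nat.lt_succ_iff_lt_or_eq.1 hv with hlt | heq
      · exact h.1 v hlt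
      · obtain rfl : v = ⟨k, hk⟩ := Fin.ext heq
        exact h.2
  rw [heval, key, h2]
  refine and_congr_right fun _ => forall_congr' fun v => ?_
  rw [arr_search henc v]
  exact ⟨fun h => h v.2, fun h _ => h⟩

theorem reg_test (henc : Encodes G r D (s.arr 3)) :
    (test.eval n D s).reg 12 ≠ 0 ↔ Valid G r (supp n (s.arr 1)) := by
  set s₁ : Store := s.setReg 12 1 with hs₁
  set s₂ : Store := (Cmd.loop 0 testAt).eval n D s₁ with hs₂
  have key : s₂.reg 12 ≠ 0 ↔ ∀ x < n, ∀ v, Demand r v x →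
      ∃ t ∈ supp n (s.arr 1), ReachIn G (avoid n x) v t :=
    eval_loop_induction_frame (n := n) (D := D) (i := 0) (P := testAt) (s := s₁)
      (fun k t => t.reg 12 ≠ 0 ↔ ∀ x < k, ∀ v, Demand r v x →
        ∃ t ∈ supp n (s.arr 1), ReachIn G (avoid n x) v t)
      (fun _ _ _ h => by simpa using h) (by simp [hs₁])
      fun k hk t hf htk h => by
        have g1 : t.arr 1 = s.arr 1 := hf.2 1 (by decide)
        have g3 : t.arr 3 = s.arr 3 := hf.2 3 (by decide)
        rw [reg_testAt (s := t) (by rw [g3]; exact henc), h, g1, htk]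
        refine ⟨fun h x hx => ?_, fun h => ⟨fun x hx => h x (by omega), h k (by omega)⟩⟩
        rcases Nat.lt_succ_iff_lt_or_eq.1 hx with hlt | rfl
        · exact h.1 x hlt
        · exact h.2
  have g1 : s₂.arr 1 = s.arr 1 := arr_eval (by decide) s₁
  have g3 : s₂.arr 3 = s.arr 3 := arr_eval (by decide) s₁
  -- The loop leaves `n` in register `0`, so the additional `testAt` covers the demands that delete
  -- no vertex; all `x ≥ n` are equivalent.
  have g0 : s₂.reg 0 = n := by simp [hs₂, eval]
  have heval : test.eval n D s = testAt.eval n D s₂ := rfl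
  rw [heval, reg_testAt (s := s₂) (by rw [g3]; exact henc), key, g0, g1]
  refine ⟨fun h v x hd => ?_, fun h => ⟨fun x _ v => h v x, fun v => h v n⟩⟩
  rcases lt_or_ge x n with hx | hx
  · exact h.1 x hx v hd
  · have := h.2 v ⟨v.2.ne, by simpa [not_lt.2 hx] using hd.2⟩
    rwa [avoid_of_le le_rfl, ← avoid_of_le hx] at this

theorem supp_pruneAt (henc : Encodes G r D (s.arr 3)) {v : Fin n} (hv : s.reg 17 = v) :
    (((v : ℕ) ≠ s.reg 15 ∧ Valid G r ((supp n (s.arr 1)).erase v)) ∧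
      supp n ((pruneAt.eval n D s).arr 1) = (supp n (s.arr 1)).erase v) ∨
    (¬ ((v : ℕ) ≠ s.reg 15 ∧ Valid G r ((supp n (s.arr 1)).erase v)) ∧
      supp n ((pruneAt.eval n D s).arr 1) = supp n (s.arr 1)) := by
  by_cases hne : (v : ℕ) = s.reg 15
  · right
    simp [pruneAt, neq, eval, skip, hv, hne]
  have h9 : ¬ ((v : ℕ) - s.reg 15 = 0 ∧ s.reg 15 - v = 0) := by omega
  set s₁ : Store := (Cmd.seq (neq 17 15) (.seq (.load 18 1 17) (.seq (.const 13 0)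
    (.store 1 17 13)))).eval n D s with hs₁
  have hsupp : supp n (s₁.arr 1) = (supp n (s.arr 1)).erase v := by
    ext w
    simp [hs₁, neq, eval, hv, Fin.ext_iff]
  have g3 : s₁.arr 3 = s.arr 3 := arr_eval (by decide) s
  have htest := reg_test (s := s₁) (G := G) (r := r) (D := D) (by rw [g3]; exact henc)
  rw [hsupp] at htest
  have h1 : (test.eval n D s₁).arr 1 = s₁.arr 1 := arr_eval (by decide) s₁
  have h17 : (test.eval n D s₁).reg 17 = v := by
    rw [reg_eval (by decide)]
    simp [hs₁, neq, eval, hv]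
  have h18 : (test.eval n D s₁).reg 18 = s.arr 1 v := by
    rw [reg_eval (by decide)]
    simp [hs₁, neq, eval, hv]
  have heval : pruneAt.eval n D s =
      (Cmd.ite 12 skip (.store 1 17 18)).eval n D (test.eval n D s₁) := by
    have : ((neq 17 15).eval n D s).reg 9 ≠ 0 := by simpa [neq, eval, hv] using h9
    rw [pruneAt, eval, eval, if_pos this]
    rfl
  rw [heval]
  by_cases hval : (test.eval n D s₁).reg 12 ≠ 0
  · refine .inl ⟨⟨hne, htest.1 hval⟩, ?_⟩
    rw [eval, if_pos hval, ← hsupp, ← h1]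
    rfl
  · refine .inr ⟨fun h => hval (htest.2 h.2), ?_⟩
    rw [eval, if_neg hval]
    ext w
    simp only [mem_supp, eval, Store.arr_setArr, h17, h18, h1]
    by_cases hwv : (w : ℕ) = v
    · simp [hwv]
    · simp [hwv, hs₁, neq, eval, hv]

/-- One pass suffices: a vertex that cannot be dropped stays indispensable when the set shrinks, by
`Valid.mono`. -/
theorem supp_prune (henc : Encodes G r D (s.arr 3)) (hval : Valid G r (supp n (s.arr 1))) :
    let T := supp n (((Cmd.loop 17 pruneAt).eval n D s).arr 1)
    Valid G r T ∧ T ⊆ supp n (s.arr 1) ∧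
      (∀ v ∈ supp n (s.arr 1), (v : ℕ) = s.reg 15 → v ∈ T) ∧
      ∀ v ∈ T, (v : ℕ) ≠ s.reg 15 → ¬ Valid G r (T.erase v) := by
  have key := eval_loop_induction_frame (n := n) (D := D) (i := 17) (P := pruneAt) (s := s)
    (fun k t => Valid G r (supp n (t.arr 1)) ∧ supp n (t.arr 1) ⊆ supp n (s.arr 1) ∧
      (∀ v ∈ supp n (s.arr 1), (v : ℕ) = s.reg 15 → v ∈ supp n (t.arr 1)) ∧
      ∀ v ∈ supp n (t.arr 1), (v : ℕ) < k → (v : ℕ) ≠ s.reg 15 →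
        ¬ Valid G r ((supp n (t.arr 1)).erase v))
    (fun _ _ _ h => h)
    ⟨hval, subset_rfl, fun _ h _ => h, fun _ _ h => absurd h (Nat.not_lt_zero _)⟩
    fun k hk t hf htk ⟨h1, h2, h3, h4⟩ => by
      have g15 : t.reg 15 = s.reg 15 := hf.1 15 (by decide)
      have g3 : t.arr 3 = s.arr 3 := hf.2 3 (by decide)
      rcases supp_pruneAt (s := t) (G := G) (r := r) (D := D) (v := ⟨k, hk⟩)
        (by rw [g3]; exact henc) htk with ⟨⟨hne, hv⟩, heq⟩ | ⟨hnot, heq⟩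
      · rw [heq]
        rw [g15] at hne
        refine ⟨hv, (Finset.erase_subset _ _).trans h2, fun v hv hv' => ?_,
          fun v hv hvk hvne hvalid => ?_⟩
        · refine Finset.mem_erase.2 ⟨?_, h3 v hv hv'⟩
          rintro rfl
          exact hne hv'
        · obtain ⟨hvk', hvt⟩ := Finset.mem_erase.1 hv
          refine h4 v hvt (lt_of_le_of_ne (Nat.lt_succ_iff.1 hvk) fun h => hvk' (Fin.ext h)) hvne
            (hvalid.mono (Finset.erase_subset_erase _ (Finset.erase_subset _ _)))
      · rw [heq]
        rw [g15] at hnot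
        refine ⟨h1, h2, h3, fun v hv hvk hvne hvalid => ?_⟩
        rcases Nat.lt_succ_iff_lt_or_eq.1 hvk with hlt | hvk
        · exact h4 v hv hlt hvne hvalid
        · obtain rfl : v = ⟨k, hk⟩ := Fin.ext hvk
          exact hnot ⟨hvne, hvalid⟩
  exact ⟨key.1, key.2.1, key.2.2.1, fun v hv => key.2.2.2 v hv v.2⟩

theorem supp_copyArr {A B : Fin 3} (hAB : A ≠ B) :
    supp n (((copyArr A B).eval n D s).arr B) = supp n (s.arr A) := by
  ext v
  rw [mem_supp, mem_supp, arr_copyArr A B hAB v v.2]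

/-- If register `15` holds `n`, the added entry lies outside the range that `supp` sees, so no
vertex is added or protected. -/
theorem supp_improveAt (henc : Encodes G r D (s.arr 3)) (hval : Valid G r (supp n (s.arr 0))) :
    ∃ T, IsPruned G r (supp n (s.arr 0)) (s.reg 15) T ∧
      supp n ((improveAt.eval n D s).arr 0) = smaller (supp n (s.arr 0)) T := by
  set s₁ : Store := (Cmd.seq (copyArr 0 1) (.seq (.const 14 1) (.store 1 15 14))).eval n D s
    with hs₁
  have g15 : s₁.reg 15 = s.reg 15 := reg_eval (by decide) s
  have g0 : s₁.arr 0 = s.arr 0 := arr_eval (by decide) s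
  have g3 : s₁.arr 3 = s.arr 3 := arr_eval (by decide) s
  have hmem : ∀ v : Fin n, v ∈ supp n (s₁.arr 1) ↔ v ∈ supp n (s.arr 0) ∨ (v : ℕ) = s.reg 15 := by
    intro v
    have h15 : ((copyArr 0 1).eval n D s).reg 15 = s.reg 15 := reg_eval (by decide) s
    have := arr_copyArr (n := n) (D := D) (s := s) 0 1 (by decide) v v.2
    simp only [Fin.val_one, Fin.val_zero] at this
    by_cases hv : (v : ℕ) = s.reg 15 <;> simp [hs₁, eval, h15, this, hv]
  obtain ⟨hT, hsub, hρ, hmin⟩ := supp_prune (s := s₁) (G := G) (r := r) (D := D)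
    (by rw [g3]; exact henc) (hval.mono fun v hv => (hmem v).2 (.inl hv))
  set s₂ : Store := (Cmd.loop 17 pruneAt).eval n D s₁ with hs₂
  rw [g15] at hρ hmin
  refine ⟨supp n (s₂.arr 1), ⟨hT, fun t ht => (hmem t).1 (hsub ht),
    fun t ht => hρ t ((hmem t).2 (.inr ht)) ht, hmin⟩, ?_⟩
  have k0 : s₂.arr 0 = s.arr 0 := (arr_eval (by decide) s₁).trans g0
  set s₃ : Store := (count 19 0).eval n D s₂ with hs₃
  set s₄ : Store := (count 20 1).eval n D s₃ with hs₄
  have c19 : s₃.reg 19 = (supp n (s.arr 0)).card := by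
    rw [hs₃, reg_count 0 (by decide)]
    exact congrArg (fun f => (supp n f).card) k0
  have c19' : s₄.reg 19 = s₃.reg 19 := reg_eval (by decide) s₃
  have a1 : s₃.arr 1 = s₂.arr 1 := arr_eval (by decide) s₂
  have c20 : s₄.reg 20 = (supp n (s₂.arr 1)).card := by
    rw [hs₄, reg_count 1 (by decide)]
    exact congrArg (fun f => (supp n f).card) a1
  have a1' : s₄.arr 1 = s₂.arr 1 := (arr_eval (by decide) s₃).trans a1
  have a0 : s₄.arr 0 = s.arr 0 :=
    ((arr_eval (by decide) s₃).trans (arr_eval (by decide) s₂)).trans k0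
  have heval : improveAt.eval n D s = (Cmd.seq (.sub 21 19 20)
      (.ite 21 (copyArr 1 0) skip)).eval n D s₄ := rfl
  rw [heval, eval, eval, eval, Store.reg_setReg, if_pos rfl, c19', c19, c20, smaller]
  by_cases hlt : (supp n (s₂.arr 1)).card < (supp n (s.arr 0)).card
  · rw [if_pos hlt, if_pos (by omega)]
    refine (supp_copyArr (A := 1) (B := 0) (by decide)).trans ?_
    exact congrArg (supp n) a1'
  · rw [if_neg hlt, if_neg (by omega)]
    exact congrArg (supp n) a0

/-- The output overwrites input cells, which is harmless since the solution stands in array `0`; `n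
≤ D` keeps every `put` within range. -/
theorem arr_output (hD : n ≤ D) (v : Fin n) :
    (output.eval n D s).arr 3 v = if s.arr 0 v ≠ 0 then 1 else 0 := by
  refine eval_loop_induction_frame (n := n) (D := D) (s := s) (i := 1)
    (P := .seq (.load 7 0 1) (.seq (.ite 7 (.const 7 1) skip) (.put 1 7)))
    (fun k t => ∀ v < k, t.arr 3 v = if s.arr 0 v ≠ 0 then 1 else 0) (fun _ _ _ h => h) (fun _ h => absurd h (Nat.not_lt_zero _)) ?_ v v.2
  intro k hk t hf htk h v hv
  have g0 : t.arr 0 = s.arr 0 := hf.2 0 (by decide)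
  have hkD : k < D := hk.trans_le hD
  rcases Nat.lt_succ_iff_lt_or_eq.1 hv with hlt | rfl
  · rw [← h v hlt]
    by_cases h0 : s.arr 0 k = 0 <;> simp [eval, skip, htk, g0, h0, hkD, hlt.ne]
  · by_cases h0 : s.arr 0 v = 0 <;> simp [eval, skip, htk, g0, h0, hkD]

theorem arr_solve (henc : Encodes G r D (s.arr 3)) : ∃ S : Finset (Fin n),
    IsImprovedUpTo G r n S ∧
      ∀ v : Fin n, (solve.eval n D s).arr 3 v = if v ∈ S then 1 else 0 := by
  set s₁ : Store := (Cmd.seq (.const 14 1) (.seq (.loop 1 (.store 0 1 14)) (.size 15))).eval n D s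
    with hs₁
  have hsupp : supp n (s₁.arr 0) = Finset.univ := by
    have key := eval_loop_induction_frame (n := n) (D := D) (s := s.setReg 14 1) (i := 1)
      (P := .store 0 1 14) (fun k t => ∀ v < k, t.arr 0 v = 1) (fun _ _ _ h => h) (fun _ h => absurd h (Nat.not_lt_zero _)) fun k hk t hf htk h v hv => by
        have g14 : t.reg 14 = 1 := hf.1 14 (by decide)
        rcases Nat.lt_succ_iff_lt_or_eq.1 hv with hlt | rfl
        · simp [eval, htk, hlt.ne, h v hlt]
        · simp [eval, htk, g14]
    refine Finset.eq_univ_of_forall fun v => mem_supp.2 ?_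
    have h1 : s₁.arr 0 v = 1 := key v v.2
    rw [h1]
    exact one_ne_zero
  have g15 : s₁.reg 15 = n := by simp [hs₁, eval]
  have g3 : s₁.arr 3 = s.arr 3 := arr_eval (by decide) s
  set s₂ : Store := improveAt.eval n D s₁ with hs₂
  have k3 : s₂.arr 3 = s.arr 3 := (arr_eval (by decide) s₁).trans g3
  have h0 : IsImprovedUpTo G r 0 (supp n (s₂.arr 0)) := by
    obtain ⟨T, hT, heq⟩ := supp_improveAt (s := s₁) (G := G) (r := r) (D := D)
      (by rw [g3]; exact henc) (by rw [hsupp]; exact valid_univ)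
    rw [hsupp, g15] at hT
    rw [hs₂, heq, hsupp]
    exact hT.isImprovedUpTo_zero
  set s₃ : Store := (Cmd.loop 15 improveAt).eval n D s₂ with hs₃
  have hn : IsImprovedUpTo G r n (supp n (s₃.arr 0)) :=
    eval_loop_induction_frame (n := n) (D := D) (s := s₂) (i := 15) (P := improveAt)
      (fun k t => IsImprovedUpTo G r k (supp n (t.arr 0))) (fun _ _ _ h => h) h0
      fun k hk t hf htk h => by
        have l3 : t.arr 3 = s.arr 3 := (hf.2 3 (by decide)).trans k3
        obtain ⟨T, hT, heq⟩ := supp_improveAt (s := t) (G := G) (r := r) (D := D)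
          (by rw [l3]; exact henc) h.1.1
        rw [htk] at hT
        rw [heq]
        exact IsPruned.isImprovedUpTo_succ (ρ := ⟨k, hk⟩) hT h
  refine ⟨_, hn, fun v => ?_⟩
  have heval : solve.eval n D s = output.eval n D s₃ := rfl
  rw [heval, arr_output (by rw [henc.length_eq]; omega) v]
  simp only [mem_supp]

end VecCon

/-! ### The encoding of the input and the final time bound -/

namespace VecCon

theorem mul_add_lt_mul {m n : ℕ} (u : Fin m) (v : Fin n) : u.1 * n + v < m * n :=
  calc u.1 * n + v < (u + 1) * n := by rw [Nat.succ_mul]; exact Nat.add_lt_add_left v.2 _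
    _ ≤ m * n := Nat.mul_le_mul_right n u.2

theorem divNat_mul_add {m n : ℕ} (u : Fin m) (v : Fin n) :
    (⟨u.1 * n + v, mul_add_lt_mul u v⟩ : Fin (m * n)).divNat = u := by
  ext
  have hn : 0 < n := (Nat.zero_le _).trans_lt v.2
  simp [Fin.divNat, Nat.add_div_of_dvd_right, Nat.div_eq_of_lt v.2, hn]

theorem modNat_mul_add {m n : ℕ} (u : Fin m) (v : Fin n) :
    (⟨u.1 * n + v, mul_add_lt_mul u v⟩ : Fin (m * n)).modNat = v := by
  ext
  simp [Fin.modNat, Nat.mod_eq_of_lt v.2]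

theorem flatten_ofFn_ofFn {α : Type*} {m n : ℕ} (f : Fin m → Fin n → α) :
    (List.ofFn fun u => List.ofFn fun v => f u v).flatten =
      List.ofFn fun k : Fin (m * n) => f k.divNat k.modNat := by
  rw [List.ofFn_mul]
  simp only [divNat_mul_add, modNat_mul_add]

theorem Input.length_encode (I : Input) : I.encode.length = 1 + I.n * I.n + I.n := by
  simp only [Input.encode, flatten_ofFn_ofFn, List.length_cons, List.length_append,
    List.length_ofFn]
  ring

theorem Input.encodes (I : Input) :
    Encodes I.graph I.req I.encode.length ((RAM.Store.init I.encode).arr 3) where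
  length_eq := I.length_encode
  adj u v := by
    have hlt := mul_add_lt_mul u v
    rw [show 1 + I.n * u.1 + v = u.1 * I.n + v + 1 by ring]
    simp only [RAM.Store.init, if_pos, Input.encode, flatten_ofFn_ofFn, List.getD_cons_succ]
    rw [List.getD_append _ _ _ _ (by simpa using hlt), List.getD_eq_getElem _ _ (by simpa using hlt),
      List.getElem_ofFn, divNat_mul_add, modNat_mul_add]
    simp
  req v := by
    rw [show 1 + I.n * I.n + v.1 = I.n * I.n + v + 1 by ring]
    simp only [RAM.Store.init, if_pos, Input.encode, flatten_ofFn_ofFn, List.getD_cons_succ]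
    rw [List.getD_append_right _ _ _ _ (by simp)]
    simp

theorem eval_le_eval_of_le (p : Polynomial ℕ) {a b : ℕ} (h : a ≤ b) : p.eval a ≤ p.eval b := by
  rw [Polynomial.eval_eq_sum_range, Polynomial.eval_eq_sum_range]
  gcongr

/-- Each of the `1 + n * n + n` numbers of the input contributes at least its separator. -/
theorem Input.n_le_inputSize (I : Input) : I.n ≤ RAM.inputSize I.encode := by
  have : I.encode.length ≤ RAM.inputSize I.encode := by
    simp [RAM.inputSize]
  rw [I.length_encode] at this
  omega

end VecCon

theorem mainTheorem5 :
    RAM.SolvableInPolyTime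
      (α := {I : VecCon.Input // ∀ v, I.req v ≤ 2})
      (β := fun I => Finset (Fin I.1.n))
      (fun I => I.1.encode)
      (fun _ S => VecCon.encodeSet S)
      (fun I S => VecCon.IsMinVectorConnectivitySet I.1.graph I.1.req S) := by
  refine ⟨VecCon.solve.toProgram, VecCon.solve.cost + 2, fun ⟨I, hr⟩ => ?_⟩
  obtain ⟨S, hS, hout⟩ := VecCon.arr_solve I.encodes
  have hlen : (VecCon.encodeSet S).length = I.n := by simp [VecCon.encodeSet]
  have key := RAM.Cmd.outputsInTime_toProgram (P := VecCon.solve) VecCon.wf_solve (x := I.encode)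
    (y := VecCon.encodeSet S) (by rw [hlen]; simp [VecCon.Input.encode])
    (by rw [hlen, I.length_encode]; omega) fun i hi => by
      rw [hlen]
      have hi' : i < I.n := hlen ▸ hi
      simpa [VecCon.encodeSet] using hout ⟨i, hi'⟩
  rw [hlen] at key
  obtain ⟨t, s, hex, ht, hs⟩ := key
  exact ⟨S, hS.isMinVectorConnectivitySet hr, t, s, hex,
    ht.trans (VecCon.eval_le_eval_of_le _ I.n_le_inputSize), hs⟩
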